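/- Let $\mathbb{D}$ be the open unit disc in $\mathbb{C}$, $dA$ the normalized area measure on $\mathbb{D}$, and for $a\in\mathbb{D}$ let $\sigma_a(z)=\frac{a-z}{1-\overline{a}z}$. Let $B_1$ be the minimal Möbius invariant space, i.e. the space of all analytic functions $f$ on $\mathbb{D}$ of the form $f(z)=\sum_{k\ge1}c_k\sigma_{a_k}(z)$ with $(c_k)\in\ell^1$ and $a_k\in\mathbb{D}$, normed by $$\|f\|_{B_1}=|f(0)|+|f'(0)|+\int_{\mathbb{D}}|f''(z)|\,dA(z).$$ Let $g$ be analytic on $\mathbb{D}$ and suppose that the multiplication operator $M_g$, $(M_gf)(z)=f(z)g(z)$, is a bounded operator on $B_1$. Then the spectrum of $M_g$ on $B_1$ is the closure in $\mathbb{C}$ of the image of $g$: $$\sigma(M_g)=\overline{g(\mathbb{D})}.$$ -/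

import Mathlib

open scoped ComplexConjugate Complex.UnitDisc

namespace MinimalMobius

/-- Extension by zero of a function on the open unit disc to the whole plane; it lets us speak of
the usual complex derivative at the points of the disc. -/
noncomputable def discExt (f : 𝔻 → ℂ) (z : ℂ) : ℂ :=
  if h : ‖z‖ < 1 then f (Complex.UnitDisc.mk z h) else 0

/-- `f ∈ H(𝔻)`: the function `f` is analytic on the open unit disc. -/
def IsAnalyticOnDisc (f : 𝔻 → ℂ) : Prop :=
  DifferentiableOn ℂ (discExt f) (Metric.ball 0 1)

/-- The disc automorphism `σ_a(z) = (a - z) / (1 - conj a * z)`. -/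
noncomputable def sigma (a : 𝔻) (z : ℂ) : ℂ :=
  ((a : ℂ) - z) / (1 - conj (a : ℂ) * z)

/-- The functions analytic on the disc that are of the form `∑ c_k σ_{a_k}` with `(c_k) ∈ ℓ¹`
and `a_k ∈ 𝔻` (the series converges absolutely, since `|σ_a| ≤ 1`). -/
def MemBesovOne (f : 𝔻 → ℂ) : Prop :=
  IsAnalyticOnDisc f ∧ ∃ (c : ℕ → ℂ) (a : ℕ → 𝔻), Summable (fun k => ‖c k‖) ∧
    ∀ z : 𝔻, f z = ∑' k, c k * sigma (a k) (z : ℂ)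

/-- The normalized area measure `dA` on the open unit disc. -/
noncomputable def areaMeasure : MeasureTheory.Measure ℂ :=
  (ENNReal.ofReal Real.pi)⁻¹ • MeasureTheory.volume.restrict (Metric.ball (0 : ℂ) 1)

/-- The norm `|f(0)| + |f'(0)| + ∫_𝔻 |f''| dA`. -/
noncomputable def besovOneNorm (f : 𝔻 → ℂ) : ℝ :=
  ‖f 0‖ + ‖deriv (discExt f) 0‖ + ∫ z, ‖deriv (deriv (discExt f)) z‖ ∂areaMeasure

/-! ### The space is a vector space -/

theorem discExt_coe (f : 𝔻 → ℂ) (z : 𝔻) : discExt f (z : ℂ) = f z := by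
  simp [discExt, z.norm_lt_one]

theorem discExt_zero (f : 𝔻 → ℂ) : discExt f 0 = f 0 := discExt_coe f 0

theorem discExt_add (f g : 𝔻 → ℂ) : discExt (f + g) = discExt f + discExt g := by
  ext z; by_cases h : ‖z‖ < 1 <;> simp [discExt, h]

theorem discExt_smul (c : ℂ) (f : 𝔻 → ℂ) : discExt (c • f) = c • discExt f := by
  ext z; by_cases h : ‖z‖ < 1 <;> simp [discExt, h]

theorem one_sub_ne_zero (a : 𝔻) {z : ℂ} (hz : ‖z‖ < 1) : 1 - conj (a : ℂ) * z ≠ 0 := by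
  intro h
  have h1 : conj (a : ℂ) * z = 1 := (sub_eq_zero.1 h).symm
  have h2 : ‖conj (a : ℂ) * z‖ < 1 := by
    rw [norm_mul, RCLike.norm_conj]
    have := a.norm_lt_one
    nlinarith [norm_nonneg z, norm_nonneg (a : ℂ)]
  rw [h1] at h2
  simp at h2

theorem norm_sigma_le (a : 𝔻) {z : ℂ} (hz : ‖z‖ < 1) : ‖sigma a z‖ ≤ 1 := by
  have hne := one_sub_ne_zero a hz
  rw [sigma, norm_div, div_le_one (norm_pos_iff.2 hne)]
  have h1 : ‖(a : ℂ) - z‖ ^ 2 ≤ ‖1 - conj (a : ℂ) * z‖ ^ 2 := by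
    have ha := a.norm_lt_one
    have ha2 : ‖(a : ℂ)‖ ^ 2 ≤ 1 := by nlinarith [norm_nonneg (a : ℂ)]
    have hz2 : ‖z‖ ^ 2 ≤ 1 := by nlinarith [norm_nonneg z]
    rw [← Complex.normSq_eq_norm_sq, Complex.normSq_apply] at ha2 hz2 ⊢
    rw [← Complex.normSq_eq_norm_sq, Complex.normSq_apply]
    simp only [Complex.sub_re, Complex.sub_im, Complex.mul_re, Complex.mul_im, Complex.conj_re,
      Complex.conj_im, Complex.one_re, Complex.one_im]
    nlinarith [mul_nonneg (sub_nonneg.2 ha2) (sub_nonneg.2 hz2)]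
  exact (sq_le_sq₀ (norm_nonneg _) (norm_nonneg _)).1 h1

theorem summable_atoms {c : ℕ → ℂ} (hc : Summable (fun k => ‖c k‖)) (a : ℕ → 𝔻) (z : 𝔻) :
    Summable (fun k => c k * sigma (a k) (z : ℂ)) := by
  refine Summable.of_norm_bounded hc fun k => ?_
  rw [norm_mul]
  exact mul_le_of_le_one_right (norm_nonneg _) (norm_sigma_le _ z.norm_lt_one)

theorem MemBesovOne.zero : MemBesovOne 0 := by
  refine ⟨?_, 0, 0, by simp, by simp⟩
  have : discExt 0 = 0 := by ext z; simp [discExt]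
  rw [IsAnalyticOnDisc, this]
  exact differentiableOn_const 0

theorem MemBesovOne.smul (r : ℂ) {f : 𝔻 → ℂ} (hf : MemBesovOne f) : MemBesovOne (r • f) := by
  obtain ⟨hd, c, a, hc, hs⟩ := hf
  refine ⟨?_, fun k => r * c k, a, ?_, fun z => ?_⟩
  · rw [IsAnalyticOnDisc, discExt_smul]
    exact DifferentiableOn.const_smul hd r
  · simpa only [norm_mul] using hc.mul_left ‖r‖
  · simp only [Pi.smul_apply, smul_eq_mul, hs z, mul_assoc, tsum_mul_left]

theorem MemBesovOne.add {f g : 𝔻 → ℂ} (hf : MemBesovOne f) (hg : MemBesovOne g) :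
    MemBesovOne (f + g) := by
  obtain ⟨hd, c, a, hc, hs⟩ := hf
  obtain ⟨hd', c', a', hc', hs'⟩ := hg
  obtain ⟨e⟩ : Nonempty (ℕ ⊕ ℕ ≃ ℕ) := ⟨Equiv.natSumNatEquivNat⟩
  refine ⟨?_, Sum.elim c c' ∘ e.symm, Sum.elim a a' ∘ e.symm, ?_, fun z => ?_⟩
  · rw [IsAnalyticOnDisc, discExt_add]
    exact DifferentiableOn.add hd hd'
  · have h : Summable (fun s : ℕ ⊕ ℕ => ‖Sum.elim c c' s‖) := by
      refine Summable.sum _ ?_ ?_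
      · exact hc
      · exact hc'
    exact (e.symm.summable_iff).2 h
  · have h : HasSum (fun s : ℕ ⊕ ℕ => Sum.elim c c' s * sigma (Sum.elim a a' s) (z : ℂ))
        ((f + g) z) := by
      refine HasSum.sum ?_ ?_
      · have := (summable_atoms hc a z).hasSum
        rw [← hs z] at this
        exact this
      · have := (summable_atoms hc' a' z).hasSum
        rw [← hs' z] at this
        exact this
    exact ((e.symm.hasSum_iff).2 h).tsum_eq.symm

/-! ### The norm is finite -/

theorem hasDerivAt_sigma (a : 𝔻) {z : ℂ} (hz : ‖z‖ < 1) :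
    HasDerivAt (sigma a) (-(1 - (a : ℂ) * conj (a : ℂ)) / (1 - conj (a : ℂ) * z) ^ 2) z := by
  have hne := one_sub_ne_zero a hz
  have h1 : HasDerivAt (fun z : ℂ => (a : ℂ) - z) (-1) z := by
    simpa using (hasDerivAt_id z).const_sub (a : ℂ)
  have h2 : HasDerivAt (fun z : ℂ => 1 - conj (a : ℂ) * z) (-conj (a : ℂ)) z := by
    simpa using ((hasDerivAt_id z).const_mul (conj (a : ℂ))).const_sub 1
  refine (h1.div h2 hne).congr_deriv ?_
  congr 1
  ring

/-- The second derivative of `σ_a`. -/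
noncomputable def sigma₂ (a : 𝔻) (z : ℂ) : ℂ :=
  -(2 * conj (a : ℂ) * (1 - (a : ℂ) * conj (a : ℂ))) / (1 - conj (a : ℂ) * z) ^ 3

theorem hasDerivAt_sigma' (a : 𝔻) {z : ℂ} (hz : ‖z‖ < 1) :
    HasDerivAt (fun z => -(1 - (a : ℂ) * conj (a : ℂ)) / (1 - conj (a : ℂ) * z) ^ 2)
      (sigma₂ a z) z := by
  have hne := one_sub_ne_zero a hz
  have h2 : HasDerivAt (fun z : ℂ => 1 - conj (a : ℂ) * z) (-conj (a : ℂ)) z := by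
    simpa using ((hasDerivAt_id z).const_mul (conj (a : ℂ))).const_sub 1
  refine ((hasDerivAt_const z _).div (h2.fun_pow 2) (pow_ne_zero 2 hne)).congr_deriv ?_
  rw [sigma₂]
  field_simp
  push_cast
  ring

theorem norm_one_sub_le (a : 𝔻) : ‖1 - (a : ℂ) * conj (a : ℂ)‖ ≤ 2 * (1 - ‖(a : ℂ)‖) := by
  have ha := a.norm_lt_one
  have h : 1 - (a : ℂ) * conj (a : ℂ) = ((1 - ‖(a : ℂ)‖ ^ 2 : ℝ) : ℂ) := by
    rw [Complex.mul_conj, Complex.normSq_eq_norm_sq]; push_cast; ring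
  rw [h, Complex.norm_real, Real.norm_eq_abs, abs_of_nonneg] <;>
    nlinarith [norm_nonneg (a : ℂ)]

theorem one_sub_le_norm (a : 𝔻) (z : ℂ) :
    1 - ‖(a : ℂ)‖ * ‖z‖ ≤ ‖1 - conj (a : ℂ) * z‖ := by
  have := norm_sub_norm_le (1 : ℂ) (conj (a : ℂ) * z)
  simpa [norm_mul] using this

theorem norm_sigma₂ (a : 𝔻) (z : ℂ) : ‖sigma₂ a z‖ =
    2 * ‖(a : ℂ)‖ * ‖1 - (a : ℂ) * conj (a : ℂ)‖ / ‖1 - conj (a : ℂ) * z‖ ^ 3 := by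
  simp [sigma₂]

theorem exists_lintegral_sigma₂_le : ∃ C : ENNReal, C ≠ ⊤ ∧ ∀ a : 𝔻,
    ∫⁻ z in Metric.ball (0 : ℂ) 1, ‖sigma₂ a z‖ₑ ≤ C := by
  have hfin : (Module.finrank ℝ ℂ : ℝ) < 3 := by rw [Complex.finrank_real_complex]; norm_num
  have hK := integrable_one_add_norm (E := ℂ) (μ := MeasureTheory.volume) hfin
  set K := ∫ x : ℂ, (1 + ‖x‖) ^ (-3 : ℝ) with hKdef
  refine ⟨ENNReal.ofReal (64 * K) + ENNReal.ofReal 16 * MeasureTheory.volume (Metric.ball (0 : ℂ) 1),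
    ?_, fun a => ?_⟩
  · exact ENNReal.add_ne_top.2 ⟨ENNReal.ofReal_ne_top,
      ENNReal.mul_ne_top ENNReal.ofReal_ne_top MeasureTheory.measure_ball_lt_top.ne⟩
  have ha := a.norm_lt_one
  have ha0 := norm_nonneg (a : ℂ)
  have hn := norm_one_sub_le a
  by_cases hsmall : ‖(a : ℂ)‖ < 1 / 2
  · refine le_trans ?_ le_add_self
    refine le_trans (MeasureTheory.setLIntegral_mono (g := fun _ => ENNReal.ofReal 16)
      measurable_const fun z hz => ?_) (by simp)
    have hz : ‖z‖ < 1 := by simpa using hz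
    rw [← ofReal_norm]
    refine ENNReal.ofReal_le_ofReal ?_
    have h1 : 1 / 2 ≤ ‖1 - conj (a : ℂ) * z‖ :=
      le_trans (by nlinarith [norm_nonneg z]) (one_sub_le_norm a z)
    have h3 : (1 / 2 : ℝ) ^ 3 ≤ ‖1 - conj (a : ℂ) * z‖ ^ 3 := by gcongr
    rw [norm_sigma₂, div_le_iff₀ (by positivity)]
    nlinarith [norm_nonneg (1 - (a : ℂ) * conj (a : ℂ))]
  · refine le_trans ?_ le_self_add
    have hapos : 0 < ‖(a : ℂ)‖ := by linarith
    have hδ : 0 < 1 - ‖(a : ℂ)‖ := by linarith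
    have hane : conj (a : ℂ) ≠ 0 := by
      rw [ne_eq, ← norm_eq_zero, RCLike.norm_conj]; exact hapos.ne'
    set δ := 1 - ‖(a : ℂ)‖ with hδdef
    set s : ℝ := ‖(a : ℂ)‖ / δ with hs
    have hspos : 0 < s := div_pos hapos hδ
    set u : ℂ := (conj (a : ℂ))⁻¹ with hu
    let h : ℂ → ℝ := fun z => 32 * ‖(a : ℂ)‖ / δ ^ 2 * (1 + ‖s • (z - u)‖) ^ (-3 : ℝ)
    have hint : MeasureTheory.Integrable h :=
      (((hK.comp_smul hspos.ne').comp_sub_right u).const_mul _)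
    have hval : ∫ z, h z = 32 * K / ‖(a : ℂ)‖ := by
      simp only [h]
      rw [MeasureTheory.integral_const_mul,
        MeasureTheory.integral_sub_right_eq_self (fun z : ℂ => (1 + ‖s • z‖) ^ (-3 : ℝ)) u,
        MeasureTheory.Measure.integral_comp_smul MeasureTheory.volume
          (fun z : ℂ => (1 + ‖z‖) ^ (-3 : ℝ)) s, Complex.finrank_real_complex, ← hKdef,
        abs_of_nonneg (by positivity), smul_eq_mul, hs]
      field_simp
    have hK0 : 0 ≤ K := MeasureTheory.integral_nonneg fun x => by positivity
    calc ∫⁻ z in Metric.ball (0 : ℂ) 1, ‖sigma₂ a z‖ₑ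
        ≤ ∫⁻ z in Metric.ball (0 : ℂ) 1, ENNReal.ofReal (h z) := by
          refine MeasureTheory.setLIntegral_mono' Metric.isOpen_ball.measurableSet fun z hz => ?_
          have hz : ‖z‖ < 1 := by simpa using hz
          rw [← ofReal_norm]
          refine ENNReal.ofReal_le_ofReal ?_
          set D := ‖1 - conj (a : ℂ) * z‖ with hD
          have h1 : δ ≤ D := le_trans (by nlinarith [norm_nonneg z]) (one_sub_le_norm a z)
          have h2 : D = ‖(a : ℂ)‖ * ‖z - u‖ := by
            rw [hD, ← RCLike.norm_conj (a : ℂ), ← norm_mul, mul_sub, hu, mul_inv_cancel₀ hane,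
              norm_sub_rev]
          have h3 : δ * (1 + ‖s • (z - u)‖) = δ + D := by
            rw [norm_smul, Real.norm_eq_abs, abs_of_pos hspos, hs, h2]; field_simp
          set T := 1 + ‖s • (z - u)‖ with hT
          have hTpos : 0 < T := by positivity
          have hDpos : 0 < D := lt_of_lt_of_le hδ h1
          have h4 : (δ * T) ^ 3 ≤ (2 * D) ^ 3 := by
            exact pow_le_pow_left₀ (by positivity) (by linarith) 3
          have h5 : h z = 32 * ‖(a : ℂ)‖ / δ ^ 2 / T ^ 3 := by
            simp only [h]
            rw [← hT, Real.rpow_neg hTpos.le, div_eq_mul_inv _ (T ^ 3)]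
            norm_cast
          rw [norm_sigma₂, h5, ← hD, div_div, div_le_div_iff₀ (by positivity) (by positivity)]
          calc 2 * ‖(a : ℂ)‖ * ‖1 - (a : ℂ) * conj (a : ℂ)‖ * (δ ^ 2 * T ^ 3)
              ≤ 2 * ‖(a : ℂ)‖ * (2 * δ) * (δ ^ 2 * T ^ 3) := by gcongr
            _ = 4 * ‖(a : ℂ)‖ * (δ * T) ^ 3 := by ring
            _ ≤ 4 * ‖(a : ℂ)‖ * (2 * D) ^ 3 := by gcongr
            _ = 32 * ‖(a : ℂ)‖ * D ^ 3 := by ring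
      _ ≤ ∫⁻ z, ENNReal.ofReal (h z) := MeasureTheory.setLIntegral_le_lintegral _ _
      _ = ENNReal.ofReal (∫ z, h z) :=
          (MeasureTheory.ofReal_integral_eq_lintegral_ofReal hint
            (Filter.Eventually.of_forall fun z => by simp only [h]; positivity)).symm
      _ ≤ ENNReal.ofReal (64 * K) := by
          refine ENNReal.ofReal_le_ofReal ?_
          rw [hval, div_le_iff₀ hapos]
          nlinarith

theorem ball_nhds {z : ℂ} (hz : ‖z‖ < 1) : Metric.ball (0 : ℂ) 1 ∈ nhds z :=
  Metric.isOpen_ball.mem_nhds (by simpa using hz)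

/-- Termwise second derivative of an atomic series. -/
theorem hasSum_deriv_deriv {f : 𝔻 → ℂ} {c : ℕ → ℂ} {a : ℕ → 𝔻} (hc : Summable (fun k => ‖c k‖))
    (hs : ∀ z : 𝔻, f z = ∑' k, c k * sigma (a k) (z : ℂ)) {z : ℂ} (hz : ‖z‖ < 1) :
    HasSum (fun k => c k * sigma₂ (a k) z) (deriv (deriv (discExt f)) z) := by
  let s' : 𝔻 → ℂ → ℂ := fun a z => -(1 - (a : ℂ) * conj (a : ℂ)) / (1 - conj (a : ℂ) * z) ^ 2
  have hE : Set.EqOn (discExt f) (fun w => ∑' k, c k * sigma (a k) w) (Metric.ball 0 1) := by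
    intro w hw
    have hw : ‖w‖ < 1 := by simpa using hw
    simpa using (discExt_coe f (.mk w hw)).trans (hs (.mk w hw))
  have h1 : Set.EqOn (deriv (discExt f)) (fun w => ∑' k, c k * s' (a k) w) (Metric.ball 0 1) := by
    intro w hw
    have hw' : ‖w‖ < 1 := by simpa using hw
    rw [(hE.eventuallyEq_of_mem (ball_nhds hw')).deriv_eq]
    have := Complex.hasSum_deriv_of_summable_norm (F := fun k w => c k * sigma (a k) w) hc
      (fun k v hv => ((hasDerivAt_sigma (a k) (by simpa using hv)).const_mul
        (c k)).differentiableAt.differentiableWithinAt) Metric.isOpen_ball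
      (fun k v hv => by
        rw [norm_mul]
        exact mul_le_of_le_one_right (norm_nonneg _) (norm_sigma_le _ (by simpa using hv))) hw
    rw [← this.tsum_eq]
    exact tsum_congr fun k => ((hasDerivAt_sigma (a k) hw').const_mul (c k)).deriv
  rw [(h1.eventuallyEq_of_mem (ball_nhds hz)).deriv_eq]
  set ρ := (1 + ‖z‖) / 2 with hρ
  have hρ1 : ρ < 1 := by rw [hρ]; linarith
  have hsub : ∀ v ∈ Metric.ball (0 : ℂ) ρ, ‖v‖ < 1 := fun v hv =>
    lt_trans (by simpa using hv) hρ1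
  have := Complex.hasSum_deriv_of_summable_norm (F := fun k w => c k * s' (a k) w)
    (U := Metric.ball (0 : ℂ) ρ) (z := z) (hc.mul_right (2 / (1 - ρ) ^ 2))
    (fun k v hv => ((hasDerivAt_sigma' (a k) (hsub v hv)).const_mul
      (c k)).differentiableAt.differentiableWithinAt) Metric.isOpen_ball
    (fun k v hv => by
      have hv1 := hsub v hv
      have hvρ : ‖v‖ < ρ := by simpa using hv
      have ha := (a k).norm_lt_one
      rw [norm_mul]
      refine mul_le_mul_of_nonneg_left ?_ (norm_nonneg _)
      simp only [s', norm_div, norm_neg, norm_pow]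
      have hn := norm_one_sub_le (a k)
      have hl := one_sub_le_norm (a k) v
      have hp : 0 < 1 - ρ := by linarith
      gcongr
      · linarith [norm_nonneg ((a k : 𝔻) : ℂ)]
      · nlinarith [norm_nonneg ((a k : 𝔻) : ℂ), norm_nonneg v])
    (by simp [hρ]; linarith)
  have he : (fun k => c k * sigma₂ (a k) z) = fun k => deriv (fun w => c k * s' (a k) w) z :=
    funext fun k => ((hasDerivAt_sigma' (a k) hz).const_mul (c k)).deriv.symm
  rw [he]
  exact this

theorem MemBesovOne.differentiableOn_deriv {f : 𝔻 → ℂ} (hf : MemBesovOne f) :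
    DifferentiableOn ℂ (deriv (discExt f)) (Metric.ball 0 1) :=
  DifferentiableOn.deriv hf.1 Metric.isOpen_ball

theorem MemBesovOne.continuousOn_deriv_deriv {f : 𝔻 → ℂ} (hf : MemBesovOne f) :
    ContinuousOn (deriv (deriv (discExt f))) (Metric.ball 0 1) :=
  (DifferentiableOn.deriv hf.differentiableOn_deriv Metric.isOpen_ball).continuousOn

/-- The second derivative of an element of the space is integrable over the disc. -/
theorem MemBesovOne.integrableOn {f : 𝔻 → ℂ} (hf : MemBesovOne f) :
    MeasureTheory.IntegrableOn (deriv (deriv (discExt f))) (Metric.ball 0 1) := by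
  refine ⟨hf.continuousOn_deriv_deriv.aestronglyMeasurable Metric.isOpen_ball.measurableSet, ?_⟩
  obtain ⟨hd, c, a, hc, hs⟩ := hf
  obtain ⟨C, hC, hCa⟩ := exists_lintegral_sigma₂_le
  have hmeas : ∀ k, Measurable (fun z => ‖c k * sigma₂ (a k) z‖ₑ) := fun k => by
    unfold sigma₂; fun_prop
  rw [MeasureTheory.hasFiniteIntegral_iff_enorm]
  calc ∫⁻ z in Metric.ball (0 : ℂ) 1, ‖deriv (deriv (discExt f)) z‖ₑ
      ≤ ∫⁻ z in Metric.ball (0 : ℂ) 1, ∑' k, ‖c k * sigma₂ (a k) z‖ₑ := by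
        refine MeasureTheory.setLIntegral_mono' Metric.isOpen_ball.measurableSet fun z hz => ?_
        rw [← (hasSum_deriv_deriv hc hs (by simpa using hz)).tsum_eq]
        exact enorm_tsum_le_tsum_enorm
    _ = ∑' k, ∫⁻ z in Metric.ball (0 : ℂ) 1, ‖c k * sigma₂ (a k) z‖ₑ :=
        MeasureTheory.lintegral_tsum fun k => (hmeas k).aemeasurable
    _ ≤ ∑' k, ‖c k‖ₑ * C := by
        refine ENNReal.tsum_le_tsum fun k => ?_
        simp only [enorm_mul]
        rw [MeasureTheory.lintegral_const_mul' _ _ enorm_ne_top]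
        gcongr
        exact hCa _
    _ < ⊤ := by
        rw [ENNReal.tsum_mul_right]
        refine ENNReal.mul_lt_top ?_ hC.lt_top
        have := hc.tsum_ofReal_lt_top
        simpa only [ofReal_norm] using this

theorem MemBesovOne.integrable {f : 𝔻 → ℂ} (hf : MemBesovOne f) :
    MeasureTheory.Integrable (deriv (deriv (discExt f))) areaMeasure :=
  hf.integrableOn.smul_measure (by simp [Real.pi_pos])

/-! ### The normed space `B₁` -/

theorem besovOneNorm_nonneg (f : 𝔻 → ℂ) : 0 ≤ besovOneNorm f := by
  have := MeasureTheory.integral_nonneg (μ := areaMeasure)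
    (f := fun z => ‖deriv (deriv (discExt f)) z‖) fun z => norm_nonneg _
  rw [besovOneNorm]
  positivity

theorem besovOneNorm_smul (r : ℂ) (f : 𝔻 → ℂ) : besovOneNorm (r • f) = ‖r‖ * besovOneNorm f := by
  have h1 : deriv (discExt (r • f)) = r • deriv (discExt f) := by
    ext z; rw [discExt_smul, deriv_const_smul_field, Pi.smul_apply]
  have h2 : deriv (deriv (discExt (r • f))) = r • deriv (deriv (discExt f)) := by
    ext z; rw [h1, deriv_const_smul_field, Pi.smul_apply]
  simp only [besovOneNorm, h2, Pi.smul_apply, norm_smul, MeasureTheory.integral_const_mul]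
  rw [h1, Pi.smul_apply, norm_smul]
  ring

theorem ae_area {p : ℂ → Prop} (h : ∀ z, ‖z‖ < 1 → p z) : ∀ᵐ z ∂areaMeasure, p z := by
  refine MeasureTheory.Measure.ae_smul_measure ?_ _
  filter_upwards [MeasureTheory.ae_restrict_mem Metric.isOpen_ball.measurableSet] with z hz
  exact h z (by simpa using hz)

theorem besovOneNorm_add_le {f g : 𝔻 → ℂ} (hf : MemBesovOne f) (hg : MemBesovOne g) :
    besovOneNorm (f + g) ≤ besovOneNorm f + besovOneNorm g := by
  have h1 : Set.EqOn (deriv (discExt (f + g))) (deriv (discExt f) + deriv (discExt g))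
      (Metric.ball 0 1) := fun z hz => by
    rw [discExt_add, deriv_add (hf.1.differentiableAt (Metric.isOpen_ball.mem_nhds hz))
      (hg.1.differentiableAt (Metric.isOpen_ball.mem_nhds hz)), Pi.add_apply]
  have h2 : ∀ z : ℂ, ‖z‖ < 1 → deriv (deriv (discExt (f + g))) z =
      deriv (deriv (discExt f)) z + deriv (deriv (discExt g)) z := fun z hz => by
    rw [(h1.eventuallyEq_of_mem (ball_nhds hz)).deriv_eq,
      deriv_add (hf.differentiableOn_deriv.differentiableAt (ball_nhds hz))
      (hg.differentiableOn_deriv.differentiableAt (ball_nhds hz))]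
  have h3 : ∫ z, ‖deriv (deriv (discExt (f + g))) z‖ ∂areaMeasure ≤
      ∫ z, ‖deriv (deriv (discExt f)) z‖ ∂areaMeasure +
        ∫ z, ‖deriv (deriv (discExt g)) z‖ ∂areaMeasure := by
    rw [← MeasureTheory.integral_add hf.integrable.norm hg.integrable.norm]
    refine MeasureTheory.integral_mono_ae (hf.add hg).integrable.norm
      (hf.integrable.norm.add hg.integrable.norm) (ae_area fun z hz => ?_)
    simp only [h2 z hz]
    exact norm_add_le _ _
  have h4 := norm_add_le (f 0) (g 0)
  have h5 := norm_add_le (deriv (discExt f) 0) (deriv (discExt g) 0)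
  have h6 := h1 (x := 0) (by simp)
  simp only [besovOneNorm, h6, Pi.add_apply]
  linarith

theorem eq_zero_of_besovOneNorm {f : 𝔻 → ℂ} (hf : MemBesovOne f) (h : besovOneNorm f = 0) :
    f = 0 := by
  have h0 := MeasureTheory.integral_nonneg (μ := areaMeasure)
    (f := fun z => ‖deriv (deriv (discExt f)) z‖) fun z => norm_nonneg _
  have hn1 := norm_nonneg (f 0)
  have hn2 := norm_nonneg (deriv (discExt f) 0)
  rw [besovOneNorm] at h
  have e1 : f 0 = 0 := norm_eq_zero.1 (by linarith)
  have e2 : deriv (discExt f) 0 = 0 := norm_eq_zero.1 (by linarith)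
  have e3 : ∫ z, ‖deriv (deriv (discExt f)) z‖ ∂areaMeasure = 0 := by linarith
  rw [areaMeasure, MeasureTheory.integral_smul_measure, smul_eq_zero,
    or_iff_right (by simp [Real.pi_pos.le, Real.pi_ne_zero]),
    MeasureTheory.integral_eq_zero_iff_of_nonneg (fun z => norm_nonneg _)
      hf.integrableOn.norm] at e3
  have e4 : Set.EqOn (deriv (deriv (discExt f))) 0 (Metric.ball 0 1) := by
    refine MeasureTheory.Measure.eqOn_open_of_ae_eq (μ := MeasureTheory.volume) ?_
      Metric.isOpen_ball hf.continuousOn_deriv_deriv continuousOn_const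
    filter_upwards [e3] with z hz
    simpa using hz
  have hpre : IsPreconnected (Metric.ball (0 : ℂ) 1) := (convex_ball _ _).isPreconnected
  have e5 : Set.EqOn (deriv (discExt f)) 0 (Metric.ball 0 1) := fun z hz => by
    rw [Metric.isOpen_ball.is_const_of_deriv_eq_zero hpre hf.differentiableOn_deriv e4 hz
      (Metric.mem_ball_self one_pos), e2, Pi.zero_apply]
  ext z
  rw [← discExt_coe f z, Metric.isOpen_ball.is_const_of_deriv_eq_zero hpre hf.1 e5
      (by simpa using z.norm_lt_one) (Metric.mem_ball_self one_pos), discExt_zero, e1, Pi.zero_apply]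

/-- The vector space of functions underlying `B₁`. -/
def besovOneSubmodule : Submodule ℂ (𝔻 → ℂ) where
  carrier := {f | MemBesovOne f}
  add_mem' hf hg := hf.add hg
  zero_mem' := MemBesovOne.zero
  smul_mem' r _ hf := hf.smul r

/-- The minimal Möbius invariant space `B₁`. It is a type of its own, so that its only topology is
the one of its norm. -/
def BesovOne : Type := besovOneSubmodule

namespace BesovOne

noncomputable instance : AddCommGroup BesovOne := inferInstanceAs (AddCommGroup besovOneSubmodule)

noncomputable instance : Module ℂ BesovOne := inferInstanceAs (Module ℂ besovOneSubmodule)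

instance : CoeFun BesovOne (fun _ => 𝔻 → ℂ) := ⟨fun f => f.1⟩

noncomputable instance : Norm BesovOne := ⟨fun f => besovOneNorm f⟩

theorem core : NormedSpace.Core ℂ BesovOne where
  norm_nonneg f := besovOneNorm_nonneg f
  norm_smul r f := besovOneNorm_smul r f
  norm_triangle f g := besovOneNorm_add_le f.2 g.2
  norm_eq_zero_iff f := by
    refine ⟨fun h => Subtype.ext (eq_zero_of_besovOneNorm f.2 h), fun h => ?_⟩
    subst h
    have := besovOneNorm_smul 0 (0 : 𝔻 → ℂ)
    rw [zero_smul, norm_zero, zero_mul] at this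
    exact this

noncomputable instance : NormedAddCommGroup BesovOne := NormedAddCommGroup.ofCore core

noncomputable instance : NormedSpace ℂ BesovOne := NormedSpace.ofCore core

end BesovOne

/-- `T` is the multiplication operator `M_g` on `B₁`, that is `(T f)(z) = f(z) g(z)`. Such a bounded
operator `T` exists (and is then unique) exactly if `M_g` is bounded on `B₁`. -/
def IsMultiplicationOperator (g : 𝔻 → ℂ) (T : BesovOne →L[ℂ] BesovOne) : Prop :=
  ∀ (f : BesovOne) (z : 𝔻), T f z = f z * g z

end MinimalMobius

namespace MinimalMobius

open MeasureTheory Metric Set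

/-! ### Integration over the disc -/

/-! Everything rests on the equivalence of the given norm with the atomic one: an analytic `f` with
integrable `f''` is a series `∑ c_k σ_{a_k}` with `∑ |c_k| ≤ C‖f‖` (`exists_hasAtomicBound`).

For this, the reproducing formula of the Bergman space with weight `1 - |w|²` writes an integrable
analytic `φ` as the integral of `-φ(w)/conj w` against `σ_w''(z)` (`integral_mul_bergmanKernel`).
Cutting the disc into small cells replaces the integral by an `ℓ¹` combination of atoms `σ_a''`,
with uniformly small error and coefficients bounded by `C‖φ‖₁` whatever the error. Iterating on the
remainder with errors `N/2^n` makes the decomposition exact (`exists_atoms_eq`). With `φ = f''`,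
only an affine function is left over; `z` is `-σ_0`, and the constants need a separate argument
(`exists_hasAtomicBound_one`).

Atomic series are bounded by `∑ |c_k|`, and products `f'g'` of derivatives of such series are
integrable, because `|σ_a'|²` is the Jacobian of a bijection of the disc. Now `g = M_g 1` lies in
`B₁`. If `|g - r| ≥ δ > 0`, each term of `(f/(g - r))''` is therefore integrable with norm
controlled by `‖f‖`, so division by `g - r` is bounded on `B₁` and inverts `M_g - r`.

Conversely, evaluation at `z` is a nonzero bounded functional `e` with `e ∘ (r - M_g) = (r - g(z))
e`. A bounded inverse `V` of `r - M_g` forces `1 ≤ |r - g(z)| ‖V‖` for all `z`, which is impossible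
for `r` in the closure of the range of `g`. -/

theorem integral_areaMeasure {E : Type*} [NormedAddCommGroup E] [NormedSpace ℝ E] (f : ℂ → E) :
    ∫ z, f z ∂areaMeasure = Real.pi⁻¹ • ∫ z in ball (0 : ℂ) 1, f z := by
  rw [areaMeasure, integral_smul_measure, ENNReal.toReal_inv, ENNReal.toReal_ofReal Real.pi_pos.le]

theorem integrable_areaMeasure_iff {E : Type*} [NormedAddCommGroup E] {f : ℂ → E} :
    Integrable f areaMeasure ↔ IntegrableOn f (ball (0 : ℂ) 1) := by
  rw [areaMeasure, integrable_smul_measure (by simp) (by simp [Real.pi_pos])]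
  rfl

theorem integral_polarCoord {f : ℂ → ℂ} (hm : Measurable f) (hi : Integrable f) :
    ∫ z, f z = ∫ r in Ioi (0 : ℝ), ∫ θ in Ioo (-Real.pi) Real.pi,
      r • f (Complex.polarCoord.symm (r, θ)) := by
  have hms : Measurable (fun p : ℝ × ℝ => f (Complex.polarCoord.symm p)) := by
    refine hm.comp (show Measurable (fun p : ℝ × ℝ => Complex.polarCoord.symm p) from ?_)
    simp only [Complex.polarCoord_symm_apply]
    fun_prop
  rw [← Complex.integral_comp_polarCoord_symm, polarCoord_target, Measure.volume_eq_prod,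
    setIntegral_prod]
  refine ⟨(measurable_fst.smul hms).aestronglyMeasurable, ?_⟩
  rw [hasFiniteIntegral_iff_enorm]
  -- Integrability on the product, needed for Fubini, follows from the polar change of variables for
  -- nonnegative functions.
  have h := Complex.lintegral_comp_polarCoord_symm (fun z => ‖f z‖ₑ)
  rw [polarCoord_target, Measure.volume_eq_prod] at h
  refine lt_of_eq_of_lt ?_ (h.trans_lt hi.2)
  refine setLIntegral_congr_fun (measurableSet_Ioi.prod measurableSet_Ioo) fun p hp => ?_
  have hp : 0 < p.1 := hp.1
  simp only [enorm_smul, smul_eq_mul, Real.enorm_eq_ofReal hp.le]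

theorem integral_circle_eq {ψ : ℂ → ℂ} (hψ : DifferentiableOn ℂ ψ (ball 0 1)) {r : ℝ}
    (h0 : 0 < r) (h1 : r < 1) :
    ∫ θ in Ioo (-Real.pi) Real.pi, ψ (Complex.polarCoord.symm (r, θ)) =
      2 * Real.pi * ψ 0 := by
  have hd : DiffContOnCl ℂ ψ (ball 0 |r|) := by
    refine (hψ.mono ?_).diffContOnCl
    rw [abs_of_pos h0]
    refine closure_ball_subset_closedBall.trans (closedBall_subset_ball h1)
  have h := hd.circleAverage
  rw [Real.circleAverage] at h
  have hc : ∀ θ : ℝ, Complex.polarCoord.symm (r, θ) = circleMap 0 r θ := fun θ => by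
    rw [Complex.polarCoord_symm_apply, circleMap, Complex.exp_mul_I]; simp
  have hper : Function.Periodic (fun θ => ψ (circleMap 0 r θ)) (2 * Real.pi) := fun θ => by
    simp only [periodic_circleMap 0 r θ]
  simp only [hc]
  rw [← integral_Ioc_eq_integral_Ioo, ← intervalIntegral.integral_of_le (by linarith [Real.pi_pos])]
  -- Polar coordinates use angles in `(-π, π)`, circle averages use `(0, 2π)`; periodicity
  -- identifies the two integrals.
  have := hper.intervalIntegral_add_eq (-Real.pi) 0
  rw [show -Real.pi + 2 * Real.pi = Real.pi by ring, zero_add] at this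
  rw [this, ← h, Complex.real_smul]
  push_cast
  field_simp

/-- The mean value property with respect to the weight `1 - |w|²`. -/
theorem integral_one_sub_sq_mul {ψ : ℂ → ℂ} (hψ : DifferentiableOn ℂ ψ (ball 0 1))
    (hi : Integrable (fun w : ℂ => ((1 - ‖w‖ ^ 2 : ℝ) : ℂ) * ψ w) areaMeasure) :
    ∫ w, ((1 - ‖w‖ ^ 2 : ℝ) : ℂ) * ψ w ∂areaMeasure = ψ 0 / 2 := by
  rw [integrable_areaMeasure_iff, ← integrable_indicator_iff measurableSet_ball] at hi
  rw [integral_areaMeasure, ← integral_indicator measurableSet_ball, integral_polarCoord _ hi]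
  · have h1 : ∀ r ∈ Ioi (0 : ℝ), (∫ θ in Ioo (-Real.pi) Real.pi, r • (ball (0 : ℂ) 1).indicator
        (fun w : ℂ => ((1 - ‖w‖ ^ 2 : ℝ) : ℂ) * ψ w) (Complex.polarCoord.symm (r, θ))) =
        (Ioo (0 : ℝ) 1).indicator
          (fun r => ((r * (1 - r ^ 2) : ℝ) : ℂ) * (2 * Real.pi * ψ 0)) r := by
      intro r hr
      have hr : 0 < r := hr
      by_cases h : r < 1
      · rw [indicator_of_mem (show r ∈ Ioo (0 : ℝ) 1 from ⟨hr, h⟩), ← integral_circle_eq hψ hr h,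
          ← integral_const_mul]
        refine integral_congr_ae (Filter.Eventually.of_forall fun θ => ?_)
        have hn : ‖Complex.polarCoord.symm (r, θ)‖ = r := by
          rw [Complex.norm_polarCoord_symm, abs_of_pos hr]
        simp only []
        rw [indicator_of_mem (by rw [mem_ball_zero_iff, hn]; exact h), hn, Complex.real_smul]
        push_cast
        ring
      · rw [indicator_of_notMem (by simp [h])]
        refine integral_eq_zero_of_ae (Filter.Eventually.of_forall fun θ => ?_)
        have hn : ‖Complex.polarCoord.symm (r, θ)‖ = r := by
          rw [Complex.norm_polarCoord_symm, abs_of_pos hr]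
        simp only [Pi.zero_apply]
        rw [indicator_of_notMem (by rw [mem_ball_zero_iff, hn]; exact h), smul_zero]
    rw [setIntegral_congr_fun measurableSet_Ioi h1, setIntegral_indicator measurableSet_Ioo,
      inter_eq_right.2 Ioo_subset_Ioi_self, integral_mul_const, integral_complex_ofReal,
      ← integral_Ioc_eq_integral_Ioo, ← intervalIntegral.integral_of_le zero_le_one]
    -- This radial factor, times `2π` from the circle and `π⁻¹` from the normalization, gives the
    -- `1/2`.
    have : ∫ r in (0 : ℝ)..1, r * (1 - r ^ 2) = 1 / 4 := by
      have : ∀ r : ℝ, r * (1 - r ^ 2) = r - r ^ 3 := fun r => by ring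
      simp only [this]
      rw [intervalIntegral.integral_sub (by simp) (by simp)]
      norm_num
    rw [this, Complex.real_smul]
    have := Real.pi_ne_zero
    push_cast
    field_simp
    ring
  · have hc : ContinuousOn (fun w : ℂ => ((1 - ‖w‖ ^ 2 : ℝ) : ℂ) * ψ w) (ball 0 1) :=
      (Continuous.continuousOn (by fun_prop)).mul hψ.continuousOn
    classical
    rw [← piecewise_eq_indicator]
    exact hc.measurable_piecewise continuousOn_const measurableSet_ball

/-! ### Change of variables by disc automorphisms -/

theorem one_sub_norm_sigma_sq (a : 𝔻) {z : ℂ} (hz : ‖z‖ < 1) :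
    1 - ‖sigma a z‖ ^ 2 =
      (1 - ‖(a : ℂ)‖ ^ 2) * (1 - ‖z‖ ^ 2) / ‖1 - conj (a : ℂ) * z‖ ^ 2 := by
  have h : 0 < ‖1 - conj (a : ℂ) * z‖ := norm_pos_iff.2 (one_sub_ne_zero a hz)
  rw [sigma, norm_div, div_pow, eq_div_iff (by positivity), sub_mul,
    div_mul_cancel₀ _ (by positivity)]
  simp only [← Complex.normSq_eq_norm_sq, Complex.normSq_apply, Complex.sub_re, Complex.sub_im,
    Complex.mul_re, Complex.mul_im, Complex.conj_re, Complex.conj_im, Complex.one_re,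
    Complex.one_im]
  ring

theorem one_sub_sq_pos {z : ℂ} (hz : ‖z‖ < 1) : 0 < 1 - ‖z‖ ^ 2 := by
  nlinarith [norm_nonneg z]

theorem norm_sigma_lt (a : 𝔻) {z : ℂ} (hz : ‖z‖ < 1) : ‖sigma a z‖ < 1 := by
  have h : 0 < ‖1 - conj (a : ℂ) * z‖ := norm_pos_iff.2 (one_sub_ne_zero a hz)
  have h1 : 0 < 1 - ‖sigma a z‖ ^ 2 := by
    rw [one_sub_norm_sigma_sq a hz]
    have := one_sub_sq_pos hz
    have := one_sub_sq_pos a.norm_lt_one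
    positivity
  nlinarith [norm_nonneg (sigma a z)]

theorem one_sub_mul_conj (a : 𝔻) : 1 - (a : ℂ) * conj (a : ℂ) = ((1 - ‖(a : ℂ)‖ ^ 2 : ℝ) : ℂ) := by
  rw [Complex.mul_conj, Complex.normSq_eq_norm_sq]; push_cast; ring

theorem one_sub_mul_conj_ne_zero (a : 𝔻) : 1 - (a : ℂ) * conj (a : ℂ) ≠ 0 := by
  rw [one_sub_mul_conj]
  exact_mod_cast (one_sub_sq_pos a.norm_lt_one).ne'

theorem one_sub_conj_mul_sigma (a : 𝔻) {z : ℂ} (hz : ‖z‖ < 1) :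
    1 - conj (a : ℂ) * sigma a z = (1 - (a : ℂ) * conj (a : ℂ)) / (1 - conj (a : ℂ) * z) := by
  have h := one_sub_ne_zero a hz
  rw [sigma, eq_div_iff h, sub_mul, mul_assoc, div_mul_cancel₀ _ h]
  ring

theorem sigma_sigma (a : 𝔻) {z : ℂ} (hz : ‖z‖ < 1) : sigma a (sigma a z) = z := by
  have h := one_sub_ne_zero a hz
  have h' := one_sub_mul_conj_ne_zero a
  conv_lhs => rw [sigma, one_sub_conj_mul_sigma a hz]
  rw [sigma, div_eq_iff (div_ne_zero h' h), eq_comm, mul_div_assoc', eq_comm, eq_div_iff h, sub_mul,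
    div_mul_cancel₀ _ h]
  ring

theorem image_sigma (a : 𝔻) : sigma a '' ball 0 1 = ball 0 1 := by
  ext z
  constructor
  · rintro ⟨w, hw, rfl⟩
    simpa using norm_sigma_lt a (by simpa using hw)
  · intro hz
    have hz : ‖z‖ < 1 := by simpa using hz
    exact ⟨sigma a z, by simpa using norm_sigma_lt a hz, sigma_sigma a hz⟩

theorem injOn_sigma (a : 𝔻) : InjOn (sigma a) (ball 0 1) := fun z hz w hw h => by
  rw [← sigma_sigma a (z := z) (by simpa using hz), h, sigma_sigma a (by simpa using hw)]

/-- The Jacobian of `σ_a`. -/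
noncomputable def sigmaJac (a : 𝔻) (z : ℂ) : ℝ :=
  ((1 - ‖(a : ℂ)‖ ^ 2) / ‖1 - conj (a : ℂ) * z‖ ^ 2) ^ 2

/-- The real determinant of a complex linear map is the norm from `ℂ` to `ℝ` of its complex
determinant. -/
theorem det_toSpanSingleton (c : ℂ) :
    ((ContinuousLinearMap.toSpanSingleton ℂ c).restrictScalars ℝ).det = ‖c‖ ^ 2 := by
  have : (((ContinuousLinearMap.toSpanSingleton ℂ c).restrictScalars ℝ : ℂ →L[ℝ] ℂ) : ℂ →ₗ[ℝ] ℂ) =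
      (LinearMap.toSpanSingleton ℂ ℂ c).restrictScalars ℝ := rfl
  rw [ContinuousLinearMap.det, this, LinearMap.det_restrictScalars, ← Complex.normSq_eq_norm_sq,
    Algebra.norm_complex_apply]
  congr 1
  rw [LinearMap.det_ring]
  simp

theorem hasFDerivWithinAt_sigma (a : 𝔻) {z : ℂ} (hz : z ∈ ball (0 : ℂ) 1) :
    HasFDerivWithinAt (sigma a) ((ContinuousLinearMap.toSpanSingleton ℂ
      (-(1 - (a : ℂ) * conj (a : ℂ)) / (1 - conj (a : ℂ) * z) ^ 2)).restrictScalars ℝ)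
      (ball 0 1) z :=
  ((hasDerivAt_sigma a (by simpa using hz)).hasFDerivAt.restrictScalars ℝ).hasFDerivWithinAt

theorem abs_det_sigma (a : 𝔻) (z : ℂ) :
    |((ContinuousLinearMap.toSpanSingleton ℂ
      (-(1 - (a : ℂ) * conj (a : ℂ)) / (1 - conj (a : ℂ) * z) ^ 2)).restrictScalars ℝ :
      ℂ →L[ℝ] ℂ).det| = sigmaJac a z := by
  rw [det_toSpanSingleton, abs_of_nonneg (by positivity), sigmaJac, norm_div, norm_neg, norm_pow,
    one_sub_mul_conj, Complex.norm_real, Real.norm_of_nonneg (one_sub_sq_pos a.norm_lt_one).le]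

theorem integral_comp_sigma (a : 𝔻) (f : ℂ → ℂ) :
    ∫ z, f z ∂areaMeasure = ∫ z, sigmaJac a z • f (sigma a z) ∂areaMeasure := by
  rw [integral_areaMeasure, integral_areaMeasure]
  congr 1
  conv_lhs => rw [← image_sigma a, integral_image_eq_integral_abs_det_fderiv_smul volume
    measurableSet_ball (fun z hz => hasFDerivWithinAt_sigma a hz) (injOn_sigma a)]
  simp only [abs_det_sigma]

theorem integrable_comp_sigma_iff (a : 𝔻) (f : ℂ → ℂ) :
    Integrable f areaMeasure ↔ Integrable (fun z => sigmaJac a z • f (sigma a z)) areaMeasure := by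
  rw [integrable_areaMeasure_iff, integrable_areaMeasure_iff]
  conv_lhs => rw [← image_sigma a, integrableOn_image_iff_integrableOn_abs_det_fderiv_smul volume
    measurableSet_ball (fun z hz => hasFDerivWithinAt_sigma a hz) (injOn_sigma a)]
  simp only [abs_det_sigma]

theorem setLIntegral_sigmaJac (a : 𝔻) :
    ∫⁻ z in ball (0 : ℂ) 1, ENNReal.ofReal (sigmaJac a z) = volume (ball (0 : ℂ) 1) := by
  have h := lintegral_image_eq_lintegral_abs_det_fderiv_mul volume
    measurableSet_ball (fun z hz => hasFDerivWithinAt_sigma a hz) (injOn_sigma a) (fun _ => 1)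
  rw [image_sigma] at h
  simp only [abs_det_sigma, mul_one] at h
  rw [← h]
  simp

/-! ### The reproducing formula -/

theorem one_sub_le_norm_one_sub {z w : ℂ} (hz : ‖z‖ ≤ 1) : 1 - ‖w‖ ≤ ‖1 - conj z * w‖ := by
  have := norm_sub_norm_le (1 : ℂ) (conj z * w)
  rw [norm_mul, RCLike.norm_conj, norm_one] at this
  nlinarith [norm_nonneg w]

theorem norm_bergmanKernel_le {z w : ℂ} (hz : ‖z‖ < 1) (hw : ‖w‖ < 1) :
    ‖2 * ((1 - ‖w‖ ^ 2 : ℝ) : ℂ) / (1 - conj w * z) ^ 3‖ ≤ 2 / (1 - ‖z‖) ^ 3 := by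
  have h1 := one_sub_le_norm_one_sub (w := z) hw.le
  have h2 := one_sub_sq_pos hw
  have h3 : 0 < 1 - ‖z‖ := by linarith
  rw [norm_div, norm_mul, norm_pow, Complex.norm_real, Real.norm_of_nonneg h2.le, Complex.norm_two]
  gcongr
  nlinarith [norm_nonneg w]

theorem integrable_mul_bergmanKernel {φ : ℂ → ℂ} (hi : Integrable φ areaMeasure) {z : ℂ}
    (hz : ‖z‖ < 1) :
    Integrable (fun w => φ w * (2 * ((1 - ‖w‖ ^ 2 : ℝ) : ℂ) / (1 - conj w * z) ^ 3))
      areaMeasure := by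
  refine (hi.norm.const_mul (2 / (1 - ‖z‖) ^ 3)).mono' (hi.1.mul ?_) (ae_area fun w hw => ?_)
  · have h : Measurable (fun w : ℂ => conj w) := Complex.continuous_conj.measurable
    exact Measurable.aestronglyMeasurable (by fun_prop)
  · rw [norm_mul, mul_comm]
    gcongr
    exact norm_bergmanKernel_le hz hw

/-- The reproducing formula of the Bergman space with weight `1 - |w|²`. -/
theorem integral_mul_bergmanKernel {φ : ℂ → ℂ} (hφ : DifferentiableOn ℂ φ (ball 0 1))
    (hi : Integrable φ areaMeasure) {z : ℂ} (hz : ‖z‖ < 1) :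
    ∫ w, φ w * (2 * ((1 - ‖w‖ ^ 2 : ℝ) : ℂ) / (1 - conj w * z) ^ 3) ∂areaMeasure = φ z := by
  obtain ⟨a, rfl⟩ : ∃ a : 𝔻, (a : ℂ) = z := ⟨.mk z hz, rfl⟩
  have hint := integrable_mul_bergmanKernel hi hz
  -- Substitute `w = σ_a(u)` with `a = z`. All powers of `1 - |a|²` from the Jacobian, the weight
  -- and the kernel cancel, leaving `2(1 - |u|²)ψ(u)` with `ψ` analytic and `ψ(0) = φ(a)`; the
  -- weighted mean value property concludes.
  set ψ : ℂ → ℂ := fun u => φ (sigma a u) / (1 - conj (a : ℂ) * u) ^ 3 with hψdef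
  have hψ : DifferentiableOn ℂ ψ (ball 0 1) := by
    refine DifferentiableOn.div (hφ.comp (fun u hu => ?_) fun u hu => ?_)
      (Differentiable.differentiableOn (by fun_prop))
      fun u hu => pow_ne_zero 3 (one_sub_ne_zero a (by simpa using hu))
    · exact (hasDerivAt_sigma a (by simpa using hu)).differentiableAt.differentiableWithinAt
    · simpa using norm_sigma_lt a (by simpa using hu)
  have key : ∀ u : ℂ, ‖u‖ < 1 → sigmaJac a u • (φ (sigma a u) *
      (2 * ((1 - ‖sigma a u‖ ^ 2 : ℝ) : ℂ) / (1 - conj (sigma a u) * a) ^ 3)) =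
      2 * (((1 - ‖u‖ ^ 2 : ℝ) : ℂ) * ψ u) := by
    intro u hu
    have hD := one_sub_ne_zero a hu
    have hA : ((1 - ‖(a : ℂ)‖ ^ 2 : ℝ) : ℂ) ≠ 0 := by
      exact_mod_cast (one_sub_sq_pos a.norm_lt_one).ne'
    have h1 : 1 - conj (sigma a u) * a =
        ((1 - ‖(a : ℂ)‖ ^ 2 : ℝ) : ℂ) / conj (1 - conj (a : ℂ) * u) := by
      rw [← Complex.conj_ofReal, ← one_sub_mul_conj, ← map_div₀, ← one_sub_conj_mul_sigma a hu]
      simp [mul_comm]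
    have hD' : conj (1 - conj (a : ℂ) * u) ≠ 0 := (map_ne_zero _).2 hD
    have h2 : ((‖1 - conj (a : ℂ) * u‖ ^ 2 : ℝ) : ℂ) =
        (1 - conj (a : ℂ) * u) * conj (1 - conj (a : ℂ) * u) := by
      rw [Complex.mul_conj, Complex.normSq_eq_norm_sq]
    rw [h1, one_sub_norm_sigma_sq a hu, sigmaJac, Complex.real_smul]
    simp only [hψdef]
    rw [Complex.ofReal_div, Complex.ofReal_pow, Complex.ofReal_div, Complex.ofReal_mul, h2]
    set D := 1 - conj (a : ℂ) * u
    field_simp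
  rw [integrable_comp_sigma_iff a,
    integrable_congr (ae_area key)] at hint
  rw [integral_comp_sigma a, integral_congr_ae (ae_area key), integral_const_mul,
    integral_one_sub_sq_mul hψ]
  · simp only [hψdef, sigma, mul_zero, sub_zero, one_pow, div_one]
    ring
  · have := hint.const_mul (1 / 2)
    simpa using this

theorem norm_le_of_integrable {φ : ℂ → ℂ} (hφ : DifferentiableOn ℂ φ (ball 0 1))
    (hi : Integrable φ areaMeasure) {z : ℂ} (hz : ‖z‖ < 1) :
    ‖φ z‖ ≤ 2 / (1 - ‖z‖) ^ 3 * ∫ w, ‖φ w‖ ∂areaMeasure := by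
  rw [← integral_mul_bergmanKernel hφ hi hz, ← integral_const_mul]
  refine norm_integral_le_of_norm_le (hi.norm.const_mul _) (ae_area fun w hw => ?_)
  rw [norm_mul, mul_comm]
  gcongr
  exact norm_bergmanKernel_le hz hw

/-- In polar coordinates the factor `r` cancels the singularity. -/
theorem integrable_norm_inv : Integrable (fun w : ℂ => ‖w‖⁻¹) areaMeasure := by
  rw [integrable_areaMeasure_iff, ← integrable_indicator_iff measurableSet_ball]
  refine ⟨((by fun_prop : Measurable fun w : ℂ => ‖w‖⁻¹).indicator
    measurableSet_ball).aestronglyMeasurable, ?_⟩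
  rw [hasFiniteIntegral_iff_enorm, ← Complex.lintegral_comp_polarCoord_symm, polarCoord_target]
  refine lt_of_le_of_lt (setLIntegral_mono' (g := (Ioo (0 : ℝ) 1 ×ˢ Ioo (-Real.pi) Real.pi).indicator
    fun _ => 1) (measurableSet_Ioi.prod measurableSet_Ioo) fun p hp => ?_) ?_
  · have hp1 : 0 < p.1 := hp.1
    have hn : ‖Complex.polarCoord.symm p‖ = p.1 := by
      rw [Complex.norm_polarCoord_symm, abs_of_pos hp1]
    by_cases h : p.1 < 1
    · rw [indicator_of_mem (show p ∈ Ioo (0 : ℝ) 1 ×ˢ Ioo (-Real.pi) Real.pi from ⟨⟨hp1, h⟩, hp.2⟩),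
        indicator_of_mem (by rw [mem_ball_zero_iff, hn]; exact h), hn,
        Real.enorm_eq_ofReal (by positivity), smul_eq_mul, ← ENNReal.ofReal_mul hp1.le,
        mul_inv_cancel₀ hp1.ne', ENNReal.ofReal_one]
    · rw [indicator_of_notMem (by rw [mem_ball_zero_iff, hn]; exact h)]
      simp
  · refine (setLIntegral_le_lintegral _ _).trans_lt ?_
    rw [lintegral_indicator (measurableSet_Ioo.prod measurableSet_Ioo), setLIntegral_one,
      Measure.volume_eq_prod, Measure.prod_prod]
    simp

/-- For `|w| < 1/2` the reproducing formula bounds `|φ(w)|` by `16‖φ‖₁`, where `16 = 2/(1/2)³`, and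
`1/|w|` is integrable; elsewhere `1/|w| ≤ 2`. This makes `φ(w)/conj w` an admissible density for the
atoms, despite the factor `conj w` by which `σ_w''` vanishes at `w = 0`. -/
theorem exists_integral_norm_div_le : ∃ C : ℝ, 0 ≤ C ∧ ∀ φ : ℂ → ℂ,
    DifferentiableOn ℂ φ (ball 0 1) → Integrable φ areaMeasure →
      Integrable (fun w => φ w / conj w) areaMeasure ∧
        ∫ w, ‖φ w / conj w‖ ∂areaMeasure ≤ C * ∫ w, ‖φ w‖ ∂areaMeasure := by
  set J := ∫ w : ℂ, ‖w‖⁻¹ ∂areaMeasure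
  have hJ : 0 ≤ J := integral_nonneg fun w => by positivity
  refine ⟨16 * J + 2, by positivity, fun φ hφ hi => ?_⟩
  set N := ∫ w, ‖φ w‖ ∂areaMeasure with hN
  have hN0 : 0 ≤ N := integral_nonneg fun w => norm_nonneg _
  have hdom : Integrable (fun w : ℂ => 16 * N * ‖w‖⁻¹ + 2 * ‖φ w‖) areaMeasure :=
    (integrable_norm_inv.const_mul _).add (hi.norm.const_mul _)
  have hle : ∀ w : ℂ, ‖w‖ < 1 → ‖φ w / conj w‖ ≤ 16 * N * ‖w‖⁻¹ + 2 * ‖φ w‖ := by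
    intro w hw
    rw [norm_div, RCLike.norm_conj, div_eq_mul_inv]
    by_cases h : ‖w‖ < 1 / 2
    · have h1 := norm_le_of_integrable hφ hi hw
      have h2 : 2 / (1 - ‖w‖) ^ 3 ≤ 16 := by
        have : (1 / 2 : ℝ) ^ 3 ≤ (1 - ‖w‖) ^ 3 := by gcongr; linarith
        rw [div_le_iff₀ (lt_of_lt_of_le (by norm_num) this)]
        linarith
      have h3 : ‖φ w‖ ≤ 16 * N := h1.trans (by gcongr)
      calc ‖φ w‖ * ‖w‖⁻¹ ≤ 16 * N * ‖w‖⁻¹ := by gcongr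
        _ ≤ _ := by linarith [norm_nonneg (φ w)]
    · have h1 : ‖w‖⁻¹ ≤ 2 := by
        rw [inv_le_comm₀ (by linarith) two_pos]; linarith
      calc ‖φ w‖ * ‖w‖⁻¹ ≤ ‖φ w‖ * 2 := by gcongr
        _ ≤ _ := by
          have : 0 ≤ 16 * N * ‖w‖⁻¹ := by positivity
          linarith
  have h : Integrable (fun w => φ w / conj w) areaMeasure := by
    refine hdom.mono' ?_ (ae_area hle)
    exact (hi.1.aemeasurable.div Complex.continuous_conj.measurable.aemeasurable).aestronglyMeasurable
  refine ⟨h, (integral_mono_ae h.norm hdom (ae_area hle)).trans_eq ?_⟩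
  rw [integral_add (integrable_norm_inv.const_mul _) (hi.norm.const_mul _), integral_const_mul,
    integral_const_mul]
  ring

/-! ### Discretization of integrals of atoms -/

/-- The second derivative of `σ_w`, for all complex `w`. -/
noncomputable def atomKernel (w z : ℂ) : ℂ :=
  -(2 * conj w * (1 - w * conj w)) / (1 - conj w * z) ^ 3

theorem sigma₂_eq_atomKernel (a : 𝔻) (z : ℂ) : sigma₂ a z = atomKernel a z := rfl

/-- For `|w| < 1` the denominator is nonzero on the whole closed disc of `z`, so the kernel is
continuous at each `(w, z)`; compactness makes the estimate uniform in `z`. -/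
theorem eventually_norm_atomKernel_sub_lt {w : ℂ} (hw : ‖w‖ < 1) {ε : ℝ} (hε : 0 < ε) :
    ∀ᶠ w' in nhds w, ∀ z ∈ closedBall (0 : ℂ) 1, ‖atomKernel w' z - atomKernel w z‖ < ε := by
  refine (isCompact_closedBall (0 : ℂ) 1).eventually_forall_of_forall_eventually
    (P := fun w' z => ‖atomKernel w' z - atomKernel w z‖ < ε) fun z hz => ?_
  have hz : ‖z‖ ≤ 1 := by simpa using hz
  have hne : (1 - conj w * z) ^ 3 ≠ 0 := by
    refine pow_ne_zero 3 fun h => ?_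
    have := one_sub_le_norm_one_sub (w := w) hz
    rw [show 1 - conj z * w = conj (1 - conj w * z) by simp [mul_comm], h] at this
    simp at this
    linarith
  have hc : ContinuousAt (fun p : ℂ × ℂ => ‖atomKernel p.1 p.2 - atomKernel w p.2‖) (w, z) := by
    unfold atomKernel
    refine ContinuousAt.norm (ContinuousAt.sub (ContinuousAt.div ?_ ?_ hne)
      (ContinuousAt.div ?_ ?_ hne))
    all_goals exact Continuous.continuousAt (by fun_prop)
  refine hc.eventually_lt continuousAt_const ?_
  simpa using hε

/-- The kernel varies ever faster as `w` nears the circle, so the admissible neighbourhood depends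
on its centre. A countable subcover by such neighbourhoods is made disjoint. -/
theorem exists_partition {ε : ℝ} (hε : 0 < ε) : ∃ (q : ℕ → 𝔻) (E : ℕ → Set ℂ),
    (∀ j, MeasurableSet (E j)) ∧ Pairwise (Function.onFun Disjoint E) ∧ ⋃ j, E j = ball 0 1 ∧
    ∀ j, ∀ w ∈ E j, ‖w - q j‖ ≤ ε ∧ ∀ z : ℂ, ‖z‖ < 1 → ‖atomKernel w z - sigma₂ (q j) z‖ ≤ ε := by
  let U : 𝔻 → Set ℂ := fun a => {w | ‖w - a‖ ≤ ε ∧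
    ∀ z : ℂ, ‖z‖ < 1 → ‖atomKernel w z - sigma₂ a z‖ ≤ ε}
  have hU : ∀ a : 𝔻, U a ∈ nhds (a : ℂ) := fun a => by
    filter_upwards [eventually_norm_atomKernel_sub_lt a.norm_lt_one hε,
      closedBall_mem_nhds (a : ℂ) hε] with w h1 h2
    exact ⟨by simpa [dist_eq_norm] using h2, fun z hz => (h1 z (by simpa using hz.le)).le⟩
  have : SecondCountableTopology 𝔻 :=
    Complex.UnitDisc.isEmbedding_coe.secondCountableTopology
  obtain ⟨s, hs, hcov⟩ := TopologicalSpace.countable_cover_nhds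
    (f := fun a : 𝔻 => (fun x : 𝔻 => (x : ℂ)) ⁻¹' interior (U a)) fun a =>
      Complex.UnitDisc.continuous_coe.continuousAt.preimage_mem_nhds (interior_mem_nhds.2 (hU a))
  have hne : s.Nonempty := by
    by_contra h
    rw [not_nonempty_iff_eq_empty] at h
    simp only [h, mem_empty_iff_false, iUnion_of_empty, iUnion_empty] at hcov
    exact (empty_ne_univ hcov)
  obtain ⟨q, rfl⟩ := hs.exists_eq_range hne
  refine ⟨q, disjointed fun j => interior (U (q j)) ∩ ball 0 1, fun j => ?_,
    disjoint_disjointed _, ?_, fun j w hw => ?_⟩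
  · exact MeasurableSet.disjointed (fun i => isOpen_interior.measurableSet.inter measurableSet_ball) j
  · rw [iUnion_disjointed, ← iUnion_inter, inter_eq_right]
    intro w hw
    have : (.mk w (by simpa using hw) : 𝔻) ∈ ⋃ x ∈ range q, (fun x : 𝔻 => (x : ℂ)) ⁻¹'
        interior (U x) := by rw [hcov]; trivial
    simpa using this
  · exact interior_subset (s := U (q j)) (disjointed_subset _ _ hw).1

theorem restrict_ball_areaMeasure : areaMeasure.restrict (ball 0 1) = areaMeasure :=
  Measure.restrict_eq_self_of_ae_mem (ae_area fun z hz => by simpa using hz)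

/-- Freezing `G` at `g j` on the cell `E j` costs at most `ε ∫_{E j} |m|`, and these errors add up.
-/
theorem norm_integral_sub_tsum_le {m G : ℂ → ℂ} {g : ℕ → ℂ} {E : ℕ → Set ℂ} {ε : ℝ}
    (hm : Integrable m areaMeasure) (hG : Integrable (fun w => m w * G w) areaMeasure)
    (hE : ∀ j, MeasurableSet (E j)) (hd : Pairwise (Function.onFun Disjoint E))
    (hU : ⋃ j, E j = ball 0 1) (h : ∀ j, ∀ w ∈ E j, ‖G w - g j‖ ≤ ε) :
    ‖∫ w, m w * G w ∂areaMeasure - ∑' j, (∫ w in E j, m w ∂areaMeasure) * g j‖ ≤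
      ε * ∫ w, ‖m w‖ ∂areaMeasure := by
  have s1 := hasSum_integral_iUnion hE hd hG.integrableOn
  have s2 := hasSum_integral_iUnion hE hd hm.norm.integrableOn
  rw [hU, restrict_ball_areaMeasure] at s1 s2
  have hb : ∀ j, ‖∫ w in E j, m w * G w ∂areaMeasure - (∫ w in E j, m w ∂areaMeasure) * g j‖ ≤
      ε * ∫ w in E j, ‖m w‖ ∂areaMeasure := fun j => by
    rw [← integral_mul_const, ← integral_sub hG.integrableOn (hm.mul_const _).integrableOn,
      ← integral_const_mul]
    refine norm_integral_le_of_norm_le (hm.norm.const_mul ε).integrableOn ?_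
    filter_upwards [ae_restrict_mem (hE j)] with w hw
    rw [← mul_sub, norm_mul, mul_comm]
    gcongr
    exact h j w hw
  have s3 := Summable.of_norm_bounded (s2.summable.mul_left ε) hb
  have s4 : Summable (fun j => (∫ w in E j, m w ∂areaMeasure) * g j) := by
    simpa using s1.summable.sub s3
  rw [← s1.tsum_eq, ← s1.summable.tsum_sub s4, ← s2.tsum_eq, ← tsum_mul_left]
  exact tsum_of_norm_bounded (s2.summable.mul_left ε).hasSum hb

/-- The same atoms serve every `z` at once. The extra estimate, for `∫ m(w) w`, concerns the value
at the origin, since `σ_w(0) = w`; it is needed only for the constants. -/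
theorem exists_atoms_near_integral {m : ℂ → ℂ} (hm : Integrable m areaMeasure)
    (hk : ∀ z : ℂ, ‖z‖ < 1 → Integrable (fun w => m w * atomKernel w z) areaMeasure)
    {ε : ℝ} (hε : 0 < ε) : ∃ (c : ℕ → ℂ) (a : ℕ → 𝔻), Summable (fun k => ‖c k‖) ∧
      ∑' k, ‖c k‖ ≤ ∫ w, ‖m w‖ ∂areaMeasure ∧
      ‖∫ w, m w * w ∂areaMeasure - ∑' k, c k * a k‖ ≤ ε ∧
      ∀ z : ℂ, ‖z‖ < 1 →
        ‖∫ w, m w * atomKernel w z ∂areaMeasure - ∑' k, c k * sigma₂ (a k) z‖ ≤ ε := by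
  set N := ∫ w, ‖m w‖ ∂areaMeasure with hN
  have hN0 : 0 ≤ N := integral_nonneg fun w => norm_nonneg _
  -- The total error is `N` times the mesh; `N + 1` avoids dividing by zero.
  obtain ⟨q, E, hE, hd, hU, h⟩ := exists_partition (ε := ε / (N + 1)) (by positivity)
  have hle : ε / (N + 1) * N ≤ ε := by
    rw [div_mul_eq_mul_div, div_le_iff₀ (by positivity)]
    nlinarith
  have s2 := hasSum_integral_iUnion hE hd hm.norm.integrableOn
  rw [hU, restrict_ball_areaMeasure] at s2
  have hb : ∀ j, ‖∫ w in E j, m w ∂areaMeasure‖ ≤ ∫ w in E j, ‖m w‖ ∂areaMeasure := fun j =>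
    norm_integral_le_integral_norm _
  have s1 := Summable.of_nonneg_of_le (fun j => norm_nonneg _) hb s2.summable
  refine ⟨fun j => ∫ w in E j, m w ∂areaMeasure, q, s1, ?_, ?_, fun z hz => ?_⟩
  · exact (s1.tsum_le_tsum hb s2.summable).trans_eq s2.tsum_eq
  · refine (norm_integral_sub_tsum_le hm ?_ hE hd hU fun j w hw => (h j w hw).1).trans hle
    refine hm.norm.mono' (hm.1.mul measurable_id.aestronglyMeasurable) (ae_area fun w hw => ?_)
    rw [norm_mul]
    exact mul_le_of_le_one_right (norm_nonneg _) hw.le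
  · exact (norm_integral_sub_tsum_le hm (hk z hz) hE hd hU
      fun j w hw => (h j w hw).2 z hz).trans hle

/-! ### Atomic decomposition -/

instance : IsProbabilityMeasure areaMeasure := by
  refine ⟨?_⟩
  rw [areaMeasure, Measure.smul_apply, Measure.restrict_apply_univ, Complex.volume_ball]
  simp only [ENNReal.ofReal_one, one_pow, one_mul, smul_eq_mul]
  rw [← NNReal.coe_real_pi, ENNReal.ofReal_coe_nnreal]
  exact ENNReal.inv_mul_cancel (by simpa using NNReal.pi_ne_zero) ENNReal.coe_ne_top

theorem ae_area_ne_zero : ∀ᵐ z ∂areaMeasure, z ≠ 0 :=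
  Measure.ae_smul_measure (ae_restrict_of_ae (by simp [ae_iff])) _

theorem integral_norm_le_of_forall {φ : ℂ → ℂ} (hi : Integrable φ areaMeasure) {ε : ℝ}
    (h : ∀ z : ℂ, ‖z‖ < 1 → ‖φ z‖ ≤ ε) : ∫ z, ‖φ z‖ ∂areaMeasure ≤ ε := by
  simpa using integral_mono_ae hi.norm (integrable_const ε) (ae_area h)

theorem atomic_isAnalyticOnDisc {c : ℕ → ℂ} {a : ℕ → 𝔻} (hc : Summable fun k => ‖c k‖) :
    IsAnalyticOnDisc (fun z : 𝔻 => ∑' k, c k * sigma (a k) (z : ℂ)) := by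
  have h : DifferentiableOn ℂ (fun z => ∑' k, c k * sigma (a k) z) (ball 0 1) := by
    refine Complex.differentiableOn_tsum_of_summable_norm hc (fun k z hz => ?_) isOpen_ball
      fun k z hz => ?_
    · exact ((hasDerivAt_sigma (a k) (by simpa using hz)).const_mul
        (c k)).differentiableAt.differentiableWithinAt
    · rw [norm_mul]
      exact mul_le_of_le_one_right (norm_nonneg _) (norm_sigma_le _ (by simpa using hz))
  refine h.congr fun z hz => ?_
  simp only [discExt, dif_pos (show ‖z‖ < 1 by simpa using hz), Complex.UnitDisc.coe_mk]

theorem atomic_memBesovOne {c : ℕ → ℂ} (a : ℕ → 𝔻) (hc : Summable fun k => ‖c k‖) :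
    MemBesovOne (fun z : 𝔻 => ∑' k, c k * sigma (a k) (z : ℂ)) :=
  ⟨atomic_isAnalyticOnDisc hc, c, a, hc, fun _ => rfl⟩

theorem atomic_deriv_deriv {c : ℕ → ℂ} (a : ℕ → 𝔻) (hc : Summable fun k => ‖c k‖) {z : ℂ}
    (hz : ‖z‖ < 1) :
    deriv (deriv (discExt fun z : 𝔻 => ∑' k, c k * sigma (a k) (z : ℂ))) z =
      ∑' k, c k * sigma₂ (a k) z :=
  (hasSum_deriv_deriv hc (fun _ => rfl) hz).tsum_eq.symm

theorem differentiableOn_tsum_sigma₂ {c : ℕ → ℂ} (a : ℕ → 𝔻) (hc : Summable fun k => ‖c k‖) :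
    DifferentiableOn ℂ (fun z => ∑' k, c k * sigma₂ (a k) z) (ball 0 1) :=
  ((atomic_memBesovOne a hc).differentiableOn_deriv.deriv isOpen_ball).congr fun _ hz =>
    (atomic_deriv_deriv a hc (by simpa using hz)).symm

theorem integrable_tsum_sigma₂ {c : ℕ → ℂ} (a : ℕ → 𝔻) (hc : Summable fun k => ‖c k‖) :
    Integrable (fun z => ∑' k, c k * sigma₂ (a k) z) areaMeasure :=
  (integrable_congr (ae_area fun _ hz => atomic_deriv_deriv a hc hz)).1
    (atomic_memBesovOne a hc).integrable

/-- Off `w = 0` the reproducing kernel is `-σ_w''(z)/conj w`, so the density to discretize is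
`-φ(w)/conj w`. The coefficient bound does not depend on `ε`, which allows iteration. -/
theorem exists_atoms_near : ∃ C : ℝ, 0 ≤ C ∧ ∀ φ : ℂ → ℂ, DifferentiableOn ℂ φ (ball 0 1) →
    Integrable φ areaMeasure → ∀ ε > 0, ∃ (c : ℕ → ℂ) (a : ℕ → 𝔻), Summable (fun k => ‖c k‖) ∧
      ∑' k, ‖c k‖ ≤ C * ∫ w, ‖φ w‖ ∂areaMeasure ∧
      ∀ z : ℂ, ‖z‖ < 1 → ‖φ z - ∑' k, c k * sigma₂ (a k) z‖ ≤ ε := by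
  obtain ⟨C, hC, h⟩ := exists_integral_norm_div_le
  refine ⟨C, hC, fun φ hφ hi ε hε => ?_⟩
  obtain ⟨h1, h2⟩ := h φ hφ hi
  have key : ∀ z : ℂ, (fun w => -(φ w / conj w) * atomKernel w z) =ᵐ[areaMeasure]
      fun w => φ w * (2 * ((1 - ‖w‖ ^ 2 : ℝ) : ℂ) / (1 - conj w * z) ^ 3) := fun z => by
    filter_upwards [ae_area_ne_zero] with w hw
    have hw' : conj w ≠ 0 := (map_ne_zero _).2 hw
    have h3 : ((1 - ‖w‖ ^ 2 : ℝ) : ℂ) = 1 - w * conj w := by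
      rw [Complex.mul_conj, Complex.normSq_eq_norm_sq]; push_cast; ring
    rw [h3, atomKernel]
    field_simp
  obtain ⟨c, a, hc, hle, -, hz⟩ := exists_atoms_near_integral h1.neg
    (fun z hz => (integrable_congr (key z)).2 (integrable_mul_bergmanKernel hi hz)) hε
  refine ⟨c, a, hc, hle.trans (by simpa using h2), fun z hz1 => ?_⟩
  have := hz z hz1
  simp only [Pi.neg_apply] at this
  rwa [integral_congr_ae (key z), integral_mul_bergmanKernel hφ hi hz1] at this

theorem norm_sigma₂_le (a : 𝔻) {z : ℂ} (hz : ‖z‖ < 1) : ‖sigma₂ a z‖ ≤ 4 / (1 - ‖z‖) ^ 3 := by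
  have ha := a.norm_lt_one
  have h1 := one_sub_le_norm_one_sub (w := z) ha.le
  have h2 : 0 < 1 - ‖z‖ := by linarith
  have h3 := norm_one_sub_le a
  rw [norm_sigma₂]
  gcongr
  nlinarith [norm_nonneg (a : ℂ), norm_nonneg (1 - (a : ℂ) * conj (a : ℂ)),
    sq_nonneg (1 - 2 * ‖(a : ℂ)‖)]

/-- Iterated approximation of an integrable analytic function by sums of atoms. -/
theorem exists_atoms_seq {C : ℝ} (hC : 0 ≤ C) (hstep : ∀ φ : ℂ → ℂ,
    DifferentiableOn ℂ φ (ball 0 1) → Integrable φ areaMeasure → ∀ ε > 0,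
      ∃ (c : ℕ → ℂ) (a : ℕ → 𝔻), Summable (fun k => ‖c k‖) ∧
      ∑' k, ‖c k‖ ≤ C * ∫ w, ‖φ w‖ ∂areaMeasure ∧
      ∀ z : ℂ, ‖z‖ < 1 → ‖φ z - ∑' k, c k * sigma₂ (a k) z‖ ≤ ε)
    {φ : ℂ → ℂ} (hφ : DifferentiableOn ℂ φ (ball 0 1)) (hi : Integrable φ areaMeasure) {N : ℝ}
    (hN : ∫ w, ‖φ w‖ ∂areaMeasure ≤ N) (hpos : 0 < N) :
    ∃ (c : ℕ → ℕ → ℂ) (a : ℕ → ℕ → 𝔻) (Φ : ℕ → ℂ → ℂ), Φ 0 = φ ∧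
      (∀ n, Summable fun k => ‖c n k‖) ∧ (∀ n, ∑' k, ‖c n k‖ ≤ C * (N / 2 ^ n)) ∧
      (∀ n z, Φ n z = ∑' k, c n k * sigma₂ (a n k) z + Φ (n + 1) z) ∧
      ∀ n, ∀ z : ℂ, ‖z‖ < 1 → ‖Φ (n + 1) z‖ ≤ N / 2 ^ (n + 1) := by
  have hnext : ∀ (n : ℕ) (ψ : {ψ : ℂ → ℂ // DifferentiableOn ℂ ψ (ball 0 1) ∧
      Integrable ψ areaMeasure}), ∃ (c : ℕ → ℂ) (a : ℕ → 𝔻) (χ : {ψ : ℂ → ℂ //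
      DifferentiableOn ℂ ψ (ball 0 1) ∧ Integrable ψ areaMeasure}), Summable (fun k => ‖c k‖) ∧
      ∑' k, ‖c k‖ ≤ C * ∫ w, ‖ψ.1 w‖ ∂areaMeasure ∧
      (∀ z, ψ.1 z = ∑' k, c k * sigma₂ (a k) z + χ.1 z) ∧
      ∀ z : ℂ, ‖z‖ < 1 → ‖χ.1 z‖ ≤ N / 2 ^ (n + 1) := by
    rintro n ⟨ψ, h1, h2⟩
    obtain ⟨c, a, hc, hle, hz⟩ := hstep ψ h1 h2 (N / 2 ^ (n + 1)) (by positivity)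
    exact ⟨c, a, ⟨fun z => ψ z - ∑' k, c k * sigma₂ (a k) z,
      h1.sub (differentiableOn_tsum_sigma₂ a hc), h2.sub (integrable_tsum_sigma₂ a hc)⟩,
      hc, hle, fun z => by simp, hz⟩
  choose c a next hc hle heq hbd using hnext
  obtain ⟨Φ, hΦ0, hΦ⟩ : ∃ Φ : ℕ → {ψ : ℂ → ℂ // DifferentiableOn ℂ ψ (ball 0 1) ∧
      Integrable ψ areaMeasure}, Φ 0 = ⟨φ, hφ, hi⟩ ∧ ∀ n, Φ (n + 1) = next n (Φ n) :=
    ⟨fun n => Nat.rec ⟨φ, hφ, hi⟩ (fun n ψ => next n ψ) n, rfl, fun _ => rfl⟩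
  have hsup : ∀ n, ∀ z : ℂ, ‖z‖ < 1 → ‖(Φ (n + 1)).1 z‖ ≤ N / 2 ^ (n + 1) := fun n z hz => by
    rw [hΦ]
    exact hbd n (Φ n) z hz
  -- The area measure has mass one, so the uniform bound on each remainder also bounds its `L¹`
  -- norm. Only `Φ 0 = φ`, which may be unbounded, is treated by its given `L¹` bound.
  have hint : ∀ n, ∫ w, ‖(Φ n).1 w‖ ∂areaMeasure ≤ N / 2 ^ n := by
    intro n
    cases n with
    | zero => rw [hΦ0, pow_zero, div_one]; exact hN
    | succ n => exact integral_norm_le_of_forall (Φ (n + 1)).2.2 (hsup n)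
  refine ⟨fun n => c n (Φ n), fun n => a n (Φ n), fun n => (Φ n).1, by simp only [hΦ0],
    fun n => hc n (Φ n), fun n => (hle n (Φ n)).trans (mul_le_mul_of_nonneg_left (hint n) hC),
    fun n z => ?_, hsup⟩
  have := heq n (Φ n) z
  rwa [← hΦ] at this

/-- Every integrable analytic function is a series of second derivatives of disc automorphisms. -/
theorem exists_atoms_eq : ∃ C : ℝ, 0 ≤ C ∧ ∀ φ : ℂ → ℂ, DifferentiableOn ℂ φ (ball 0 1) →
    Integrable φ areaMeasure → ∃ (c : ℕ → ℂ) (a : ℕ → 𝔻), Summable (fun k => ‖c k‖) ∧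
      ∑' k, ‖c k‖ ≤ C * ∫ w, ‖φ w‖ ∂areaMeasure ∧
      ∀ z : ℂ, ‖z‖ < 1 → φ z = ∑' k, c k * sigma₂ (a k) z := by
  obtain ⟨C, hC, hstep⟩ := exists_atoms_near
  -- The factor `2` is `∑ 2^{-n}`, from summing the coefficient bounds of all rounds.
  refine ⟨2 * C, by positivity, fun φ hφ hi => ?_⟩
  set N := ∫ w, ‖φ w‖ ∂areaMeasure with hN
  have hN0 : 0 ≤ N := integral_nonneg fun w => norm_nonneg _
  rcases hN0.eq_or_lt with h0 | hpos
  · refine ⟨0, 0, by simp, by simp [← h0], fun z hz => ?_⟩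
    have := norm_le_of_integrable hφ hi hz
    rw [← hN, ← h0, mul_zero] at this
    simpa using this
  obtain ⟨c, a, Φ, hΦ0, hc, hle, heq, hsup⟩ := exists_atoms_seq hC hstep hφ hi hN.ge hpos
  have hle' : ∀ n, ∑' k, ‖c n k‖ ≤ C * N * (1 / 2) ^ n := fun n =>
    (hle n).trans_eq (by rw [one_div, inv_pow]; ring)
  have hgeo : Summable (fun n : ℕ => C * N * (1 / 2 : ℝ) ^ n) :=
    summable_geometric_two.mul_left _
  have hs1 : Summable (fun n => ∑' k, ‖c n k‖) :=
    Summable.of_nonneg_of_le (fun n => tsum_nonneg fun k => norm_nonneg _) hle' hgeo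
  have hs : Summable (fun p : ℕ × ℕ => ‖c p.1 p.2‖) :=
    (summable_prod_of_nonneg fun p => norm_nonneg _).2 ⟨hc, hs1⟩
  obtain ⟨e⟩ : Nonempty (ℕ ≃ ℕ × ℕ) := ⟨Nat.pairEquiv.symm⟩
  refine ⟨fun k => c (e k).1 (e k).2, fun k => a (e k).1 (e k).2,
    (e.summable_iff).2 hs, ?_, fun z hz => ?_⟩
  · rw [e.tsum_eq (fun p : ℕ × ℕ => ‖c p.1 p.2‖), hs.tsum_prod]
    refine (hs1.tsum_le_tsum hle' hgeo).trans_eq ?_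
    rw [tsum_mul_left, tsum_geometric_two]
    ring
  · rw [e.tsum_eq (fun p : ℕ × ℕ => c p.1 p.2 * sigma₂ (a p.1 p.2) z)]
    have hsz : Summable (fun p : ℕ × ℕ => c p.1 p.2 * sigma₂ (a p.1 p.2) z) := by
      refine Summable.of_norm_bounded (hs.mul_right (4 / (1 - ‖z‖) ^ 3)) fun p => ?_
      rw [norm_mul]
      exact mul_le_mul_of_nonneg_left (norm_sigma₂_le _ hz) (norm_nonneg _)
    have htel : ∀ n, ∑ i ∈ Finset.range n, ∑' k, c i k * sigma₂ (a i k) z = φ z - Φ n z := by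
      intro n
      induction n with
      | zero => rw [hΦ0, Finset.sum_range_zero, sub_self]
      | succ n ih => rw [Finset.sum_range_succ, ih, heq n z]; ring
    have hlim : Filter.Tendsto (fun n => Φ n z) Filter.atTop (nhds 0) := by
      refine squeeze_zero_norm' (a := fun n => N * (1 / 2) ^ n) ?_ ?_
      -- The pointwise bound on remainders starts at index one.
      · filter_upwards [Filter.eventually_ge_atTop 1] with n hn
        obtain ⟨n, rfl⟩ := Nat.exists_eq_add_of_le' hn
        refine (hsup n z hz).trans_eq ?_
        rw [one_div, inv_pow]; ring
      · simpa using (tendsto_pow_atTop_nhds_zero_of_lt_one (by norm_num : (0 : ℝ) ≤ 1 / 2)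
          (by norm_num)).const_mul N
    have h1 := hsz.prod.hasSum.tendsto_sum_nat
    simp only [htel] at h1
    have h2 := tendsto_const_nhds (x := φ z).sub hlim
    rw [sub_zero] at h2
    rw [hsz.tsum_prod]
    exact tendsto_nhds_unique h2 h1

/-! ### Constants belong to the space -/

theorem integrable_conj_mul_atomKernel {z : ℂ} (hz : ‖z‖ < 1) :
    Integrable (fun w => conj w * atomKernel w z) areaMeasure := by
  have hm : Measurable (fun w : ℂ => conj w) := Complex.continuous_conj.measurable
  refine Integrable.of_bound (C := 4 / (1 - ‖z‖) ^ 3)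
    (Measurable.aestronglyMeasurable (by unfold atomKernel; fun_prop)) (ae_area fun w hw => ?_)
  have := norm_sigma₂_le (.mk w hw) hz
  rw [sigma₂_eq_atomKernel, Complex.UnitDisc.coe_mk] at this
  rw [norm_mul, RCLike.norm_conj]
  exact (mul_le_of_le_one_left (norm_nonneg _) hw.le).trans this

/-- The integrand is the conjugate of `1 - |w|²` times an analytic function of `w` vanishing at the
origin. -/
theorem integral_conj_mul_atomKernel {z : ℂ} (hz : ‖z‖ < 1) :
    ∫ w, conj w * atomKernel w z ∂areaMeasure = 0 := by
  let ψ : ℂ → ℂ := fun w => -(2 * w ^ 2) / (1 - conj z * w) ^ 3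
  have key : ∀ w, conj w * atomKernel w z = conj (((1 - ‖w‖ ^ 2 : ℝ) : ℂ) * ψ w) := fun w => by
    have h3 : ((1 - ‖w‖ ^ 2 : ℝ) : ℂ) = 1 - w * conj w := by
      rw [Complex.mul_conj, Complex.normSq_eq_norm_sq]; push_cast; ring
    simp only [map_mul, ψ, h3, atomKernel, map_div₀, map_neg, map_pow,
      map_sub, map_one, Complex.conj_conj, map_ofNat]
    ring
  have hint := integrable_conj_mul_atomKernel hz
  simp only [key] at hint ⊢
  have hψ : DifferentiableOn ℂ ψ (ball 0 1) := by
    refine DifferentiableOn.div (Differentiable.differentiableOn (by fun_prop))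
      (Differentiable.differentiableOn (by fun_prop)) fun u hu => pow_ne_zero 3 ?_
    exact one_sub_ne_zero (.mk z hz) (by simpa using hu)
  rw [integral_conj, integral_one_sub_sq_mul hψ]
  · simp [ψ]
  · have := (LinearIsometryEquiv.integrable_comp_iff (Complex.conjLIE)).1 hint
    exact this

theorem integral_conj_mul_self : ∫ w, conj w * w ∂areaMeasure = 1 / 2 := by
  have h1 : Integrable (fun w : ℂ => ((1 - ‖w‖ ^ 2 : ℝ) : ℂ) * 1) areaMeasure := by
    refine Integrable.of_bound (C := 1) (Measurable.aestronglyMeasurable (by fun_prop))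
      (ae_area fun w hw => ?_)
    rw [mul_one, Complex.norm_real, Real.norm_of_nonneg (one_sub_sq_pos hw).le]
    nlinarith [norm_nonneg w]
  have h2 := integral_one_sub_sq_mul (ψ := fun _ => 1) (differentiableOn_const 1) h1
  have h3 : ∀ w : ℂ, conj w * w = 1 - ((1 - ‖w‖ ^ 2 : ℝ) : ℂ) * 1 := fun w => by
    rw [mul_comm, Complex.mul_conj, Complex.normSq_eq_norm_sq]; push_cast; ring
  simp only [h3]
  rw [integral_sub (integrable_const 1) h1, h2]
  simp
  norm_num

theorem eq_affine_of_deriv_deriv_eq_zero {F : ℂ → ℂ} (hF : DifferentiableOn ℂ F (ball 0 1))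
    (h : ∀ z : ℂ, ‖z‖ < 1 → deriv (deriv F) z = 0) {z : ℂ} (hz : ‖z‖ < 1) :
    F z = F 0 + deriv F 0 * z := by
  have hpre : IsPreconnected (ball (0 : ℂ) 1) := (convex_ball _ _).isPreconnected
  have h1 : ∀ w ∈ ball (0 : ℂ) 1, deriv F w = deriv F 0 := fun w hw =>
    isOpen_ball.is_const_of_deriv_eq_zero hpre (hF.deriv isOpen_ball)
      (fun z hz => h z (by simpa using hz)) hw (mem_ball_self one_pos)
  have hG : DifferentiableOn ℂ (fun w => F w - deriv F 0 * w) (ball 0 1) :=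
    hF.sub (Differentiable.differentiableOn (by fun_prop))
  have h2 : EqOn (deriv fun w => F w - deriv F 0 * w) 0 (ball 0 1) := fun w hw => by
    have hd := (hF.differentiableAt (isOpen_ball.mem_nhds hw)).hasDerivAt.sub
      ((hasDerivAt_id w).const_mul (deriv F 0))
    have := hd.deriv
    simp only [h1 w hw, mul_one, sub_self] at this
    exact this
  have := isOpen_ball.is_const_of_deriv_eq_zero hpre hG h2 (x := z) (y := 0) (by simpa using hz)
    (mem_ball_self one_pos)
  simp only [mul_zero, sub_zero] at this
  rw [← this]
  ring

/-! ### Atomic series with a bound on the coefficients -/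

/-- `f` is a series of disc automorphisms whose coefficients have `ℓ¹` norm at most `B`. -/
def HasAtomicBound (f : 𝔻 → ℂ) (B : ℝ) : Prop :=
  ∃ (c : ℕ → ℂ) (a : ℕ → 𝔻), Summable (fun k => ‖c k‖) ∧ ∑' k, ‖c k‖ ≤ B ∧
    ∀ z : 𝔻, f z = ∑' k, c k * sigma (a k) (z : ℂ)

theorem HasAtomicBound.smul {f : 𝔻 → ℂ} {B : ℝ} (hf : HasAtomicBound f B) (r : ℂ) :
    HasAtomicBound (r • f) (‖r‖ * B) := by
  obtain ⟨c, a, hc, hB, hs⟩ := hf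
  refine ⟨fun k => r * c k, a, ?_, ?_, fun z => ?_⟩
  · simpa only [norm_mul] using hc.mul_left ‖r‖
  · simp only [norm_mul, tsum_mul_left]
    gcongr
  · simp only [Pi.smul_apply, smul_eq_mul, hs z, mul_assoc, tsum_mul_left]

theorem HasAtomicBound.add {f g : 𝔻 → ℂ} {B B' : ℝ} (hf : HasAtomicBound f B)
    (hg : HasAtomicBound g B') : HasAtomicBound (f + g) (B + B') := by
  obtain ⟨c, a, hc, hB, hs⟩ := hf
  obtain ⟨c', a', hc', hB', hs'⟩ := hg
  obtain ⟨e⟩ : Nonempty (ℕ ⊕ ℕ ≃ ℕ) := ⟨Equiv.natSumNatEquivNat⟩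
  have h1 : HasSum (fun s : ℕ ⊕ ℕ => ‖Sum.elim c c' s‖) (∑' k, ‖c k‖ + ∑' k, ‖c' k‖) := by
    refine HasSum.sum ?_ ?_
    · exact hc.hasSum
    · exact hc'.hasSum
  have h2 := (e.symm.hasSum_iff).2 h1
  refine ⟨Sum.elim c c' ∘ e.symm, Sum.elim a a' ∘ e.symm, h2.summable,
    h2.tsum_eq.trans_le (add_le_add hB hB'), fun z => ?_⟩
  have h : HasSum (fun s : ℕ ⊕ ℕ => Sum.elim c c' s * sigma (Sum.elim a a' s) (z : ℂ))
      ((f + g) z) := by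
    refine HasSum.sum ?_ ?_
    · have := (summable_atoms hc a z).hasSum
      rw [← hs z] at this
      exact this
    · have := (summable_atoms hc' a' z).hasSum
      rw [← hs' z] at this
      exact this
  exact ((e.symm.hasSum_iff).2 h).tsum_eq.symm

theorem MemBesovOne.exists_hasAtomicBound {f : 𝔻 → ℂ} (hf : MemBesovOne f) :
    ∃ B, HasAtomicBound f B := by
  obtain ⟨-, c, a, hc, hs⟩ := hf
  exact ⟨_, c, a, hc, le_rfl, hs⟩

theorem HasAtomicBound.norm_le {f : 𝔻 → ℂ} {B : ℝ} (hf : HasAtomicBound f B) (z : 𝔻) :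
    ‖f z‖ ≤ B := by
  obtain ⟨c, a, hc, hB, hs⟩ := hf
  rw [hs z]
  refine (tsum_of_norm_bounded hc.hasSum fun k => ?_).trans hB
  rw [norm_mul]
  exact mul_le_of_le_one_right (norm_nonneg _) (norm_sigma_le _ z.norm_lt_one)

/-! ### First derivatives of atomic series and their products -/

/-- The derivative of `σ_a`. -/
noncomputable def sigma₁ (a : 𝔻) (z : ℂ) : ℂ :=
  -(1 - (a : ℂ) * conj (a : ℂ)) / (1 - conj (a : ℂ) * z) ^ 2

theorem norm_sigma₁_sq (a : 𝔻) (z : ℂ) : ‖sigma₁ a z‖ ^ 2 = sigmaJac a z := by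
  rw [← abs_det_sigma, det_toSpanSingleton, abs_of_nonneg (by positivity), sigma₁]

/-- Termwise derivative of an atomic series. -/
theorem hasSum_deriv {f : 𝔻 → ℂ} {c : ℕ → ℂ} {a : ℕ → 𝔻} (hc : Summable (fun k => ‖c k‖))
    (hs : ∀ z : 𝔻, f z = ∑' k, c k * sigma (a k) (z : ℂ)) {z : ℂ} (hz : ‖z‖ < 1) :
    HasSum (fun k => c k * sigma₁ (a k) z) (deriv (discExt f) z) := by
  have hE : EqOn (discExt f) (fun w => ∑' k, c k * sigma (a k) w) (ball 0 1) := by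
    intro w hw
    have hw : ‖w‖ < 1 := by simpa using hw
    simpa using (discExt_coe f (.mk w hw)).trans (hs (.mk w hw))
  rw [(hE.eventuallyEq_of_mem (ball_nhds hz)).deriv_eq]
  have := Complex.hasSum_deriv_of_summable_norm (F := fun k w => c k * sigma (a k) w) hc
    (fun k v hv => ((hasDerivAt_sigma (a k) (by simpa using hv)).const_mul
      (c k)).differentiableAt.differentiableWithinAt) isOpen_ball
    (fun k v hv => by
      rw [norm_mul]
      exact mul_le_of_le_one_right (norm_nonneg _) (norm_sigma_le _ (by simpa using hv)))
    (show z ∈ ball (0 : ℂ) 1 by simpa using hz)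
  have he : (fun k => c k * sigma₁ (a k) z) = fun k => deriv (fun w => c k * sigma (a k) w) z :=
    funext fun k => ((hasDerivAt_sigma (a k) hz).const_mul (c k)).deriv.symm
  rw [he]
  exact this

theorem HasAtomicBound.norm_deriv_zero_le {f : 𝔻 → ℂ} {B : ℝ} (hf : HasAtomicBound f B) :
    ‖deriv (discExt f) 0‖ ≤ 2 * B := by
  obtain ⟨c, a, hc, hB, hs⟩ := hf
  rw [← (hasSum_deriv hc hs (z := 0) (by simp)).tsum_eq]
  refine (tsum_of_norm_bounded (hc.mul_left 2).hasSum fun k => ?_).trans ?_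
  · rw [norm_mul, mul_comm]
    gcongr
    have := norm_one_sub_le (a k)
    simp only [sigma₁, mul_zero, sub_zero, one_pow, div_one, norm_neg]
    linarith [norm_nonneg ((a k : 𝔻) : ℂ)]
  · rw [tsum_mul_left]
    gcongr

theorem lintegral_sigmaJac (a : 𝔻) :
    ∫⁻ z, ENNReal.ofReal (sigmaJac a z) ∂areaMeasure = 1 := by
  rw [areaMeasure, lintegral_smul_measure, setLIntegral_sigmaJac, ← Measure.restrict_apply_univ]
  exact (measure_univ : areaMeasure univ = 1)

/-- `|xy| ≤ |x|² + |y|²`, and each `|σ'|²` is a Jacobian of total mass one. -/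
theorem lintegral_sigma₁_mul_le (a b : 𝔻) :
    ∫⁻ z, ‖sigma₁ a z‖ₑ * ‖sigma₁ b z‖ₑ ∂areaMeasure ≤ 2 := by
  have hm : Measurable fun z => ENNReal.ofReal (sigmaJac a z) := by unfold sigmaJac; fun_prop
  calc ∫⁻ z, ‖sigma₁ a z‖ₑ * ‖sigma₁ b z‖ₑ ∂areaMeasure
      ≤ ∫⁻ z, (ENNReal.ofReal (sigmaJac a z) + ENNReal.ofReal (sigmaJac b z)) ∂areaMeasure := by
        refine lintegral_mono fun z => ?_
        rw [← ofReal_norm, ← ofReal_norm, ← ENNReal.ofReal_mul (norm_nonneg _),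
          ← norm_sigma₁_sq, ← norm_sigma₁_sq, ← ENNReal.ofReal_add (by positivity) (by positivity)]
        refine ENNReal.ofReal_le_ofReal ?_
        nlinarith [sq_nonneg (‖sigma₁ a z‖ - ‖sigma₁ b z‖), sq_nonneg ‖sigma₁ a z‖,
          sq_nonneg ‖sigma₁ b z‖]
    _ = 2 := by
        rw [lintegral_add_left hm, lintegral_sigmaJac, lintegral_sigmaJac]
        norm_num

/-- Expanding both series reduces the claim to pairs of atoms, whose integrals are at most `2`
uniformly. -/
theorem HasAtomicBound.lintegral_deriv_mul_deriv_le {f g : 𝔻 → ℂ} {B B' : ℝ}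
    (hf : HasAtomicBound f B) (hg : HasAtomicBound g B') :
    ∫⁻ z, ‖deriv (discExt f) z * deriv (discExt g) z‖ₑ ∂areaMeasure ≤
      ENNReal.ofReal (2 * (B * B')) := by
  obtain ⟨c, a, hc, hB, hs⟩ := hf
  obtain ⟨c', a', hc', hB', hs'⟩ := hg
  have hm : ∀ k, Measurable fun z => ‖sigma₁ (a k) z‖ₑ := fun k => by unfold sigma₁; fun_prop
  have hm' : ∀ k, Measurable fun z => ‖sigma₁ (a' k) z‖ₑ := fun k => by unfold sigma₁; fun_prop
  have hsum : ∀ {d : ℕ → ℂ} {D : ℝ}, Summable (fun k => ‖d k‖) → ∑' k, ‖d k‖ ≤ D →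
      ∑' k, ‖d k‖ₑ ≤ ENNReal.ofReal D := fun {d D} hd hD => by
    simp only [← ofReal_norm]
    rw [← ENNReal.ofReal_tsum_of_nonneg (fun k => norm_nonneg _) hd]
    exact ENNReal.ofReal_le_ofReal hD
  have hB0 : 0 ≤ B := (tsum_nonneg fun k => norm_nonneg _).trans hB
  calc ∫⁻ z, ‖deriv (discExt f) z * deriv (discExt g) z‖ₑ ∂areaMeasure
      ≤ ∫⁻ z, ∑' k, ∑' l, ‖c k‖ₑ * (‖c' l‖ₑ * (‖sigma₁ (a k) z‖ₑ * ‖sigma₁ (a' l) z‖ₑ))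
          ∂areaMeasure := by
        refine lintegral_mono_ae (ae_area fun z hz => ?_)
        rw [enorm_mul, ← (hasSum_deriv hc hs hz).tsum_eq, ← (hasSum_deriv hc' hs' hz).tsum_eq]
        refine (mul_le_mul' enorm_tsum_le_tsum_enorm enorm_tsum_le_tsum_enorm).trans_eq ?_
        rw [← ENNReal.tsum_mul_right]
        refine tsum_congr fun k => ?_
        rw [← ENNReal.tsum_mul_left]
        refine tsum_congr fun l => ?_
        rw [enorm_mul, enorm_mul]
        ring
    _ = ∑' k, ∑' l, ∫⁻ z, ‖c k‖ₑ * (‖c' l‖ₑ * (‖sigma₁ (a k) z‖ₑ * ‖sigma₁ (a' l) z‖ₑ))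
          ∂areaMeasure := by
        have h1 : ∀ k l, Measurable fun z =>
            ‖c k‖ₑ * (‖c' l‖ₑ * (‖sigma₁ (a k) z‖ₑ * ‖sigma₁ (a' l) z‖ₑ)) := fun k l =>
          (((hm k).mul (hm' l)).const_mul _).const_mul _
        rw [lintegral_tsum fun k => (Measurable.tsum (h1 k)).aemeasurable]
        exact tsum_congr fun k => lintegral_tsum fun l => (h1 k l).aemeasurable
    _ ≤ ∑' k, ∑' l, ‖c k‖ₑ * (‖c' l‖ₑ * 2) := by
        refine ENNReal.tsum_le_tsum fun k => ENNReal.tsum_le_tsum fun l => ?_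
        rw [lintegral_const_mul' _ _ enorm_ne_top, lintegral_const_mul' _ _ enorm_ne_top]
        gcongr
        exact lintegral_sigma₁_mul_le _ _
    _ = (∑' k, ‖c k‖ₑ) * (∑' l, ‖c' l‖ₑ) * 2 := by
        simp only [ENNReal.tsum_mul_left, ENNReal.tsum_mul_right, mul_assoc]
    _ ≤ ENNReal.ofReal B * ENNReal.ofReal B' * 2 := by
        gcongr
        · exact hsum hc hB
        · exact hsum hc' hB'
    _ = ENNReal.ofReal (2 * (B * B')) := by
        rw [ENNReal.ofReal_mul zero_le_two, ENNReal.ofReal_mul hB0, mul_comm]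
        simp

theorem integrable_deriv_mul_deriv {f g : 𝔻 → ℂ} (hf : MemBesovOne f) (hg : MemBesovOne g) :
    Integrable (fun z => deriv (discExt f) z * deriv (discExt g) z) areaMeasure := by
  obtain ⟨B, hB⟩ := hf.exists_hasAtomicBound
  obtain ⟨B', hB'⟩ := hg.exists_hasAtomicBound
  refine ⟨?_, (hB.lintegral_deriv_mul_deriv_le hB').trans_lt ENNReal.ofReal_lt_top⟩
  exact ((hf.differentiableOn_deriv.mul hg.differentiableOn_deriv).continuousOn.aestronglyMeasurable
    measurableSet_ball).smul_measure _

theorem integral_deriv_mul_deriv_le {f g : 𝔻 → ℂ} (hf : MemBesovOne f) (hg : MemBesovOne g)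
    {B B' : ℝ} (hB : HasAtomicBound f B) (hB' : HasAtomicBound g B') :
    ∫ z, ‖deriv (discExt f) z * deriv (discExt g) z‖ ∂areaMeasure ≤ 2 * (B * B') := by
  have h0 : 0 ≤ B := (norm_nonneg (f 0)).trans (hB.norm_le 0)
  have h0' : 0 ≤ B' := (norm_nonneg (g 0)).trans (hB'.norm_le 0)
  rw [integral_norm_eq_lintegral_enorm (integrable_deriv_mul_deriv hf hg).1]
  exact ENNReal.toReal_le_of_le_ofReal (by positivity) (hB.lintegral_deriv_mul_deriv_le hB')

/-! ### From an integrable second derivative to an atomic series -/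

theorem discExt_of_norm_lt (f : 𝔻 → ℂ) {z : ℂ} (hz : ‖z‖ < 1) : discExt f z = f (.mk z hz) :=
  dif_pos hz

theorem deriv_discExt_sub {f g : 𝔻 → ℂ} (hf : IsAnalyticOnDisc f) (hg : IsAnalyticOnDisc g)
    {z : ℂ} (hz : ‖z‖ < 1) : deriv (discExt (f - g)) z = deriv (discExt f) z - deriv (discExt g) z ∧
      deriv (deriv (discExt (f - g))) z =
        deriv (deriv (discExt f)) z - deriv (deriv (discExt g)) z := by
  have h0 : discExt (f - g) = discExt f - discExt g := by
    ext z; by_cases h : ‖z‖ < 1 <;> simp [discExt, h]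
  have h1 : EqOn (deriv (discExt (f - g))) (deriv (discExt f) - deriv (discExt g)) (ball 0 1) :=
    fun z hz => by
      rw [h0, deriv_sub (hf.differentiableAt (isOpen_ball.mem_nhds hz))
        (hg.differentiableAt (isOpen_ball.mem_nhds hz)), Pi.sub_apply]
  refine ⟨h1 (by simpa using hz), ?_⟩
  rw [(h1.eventuallyEq_of_mem (ball_nhds hz)).deriv_eq,
    deriv_sub ((DifferentiableOn.deriv hf isOpen_ball).differentiableAt (ball_nhds hz))
      ((DifferentiableOn.deriv hg isOpen_ball).differentiableAt (ball_nhds hz))]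

theorem hasAtomicBound_id : HasAtomicBound (fun z : 𝔻 => (z : ℂ)) 1 := by
  -- The identity is `-σ_0`.
  refine ⟨fun k => if k = 0 then -1 else 0, fun _ => 0, ?_, ?_, fun z => ?_⟩
  · exact summable_of_ne_finset_zero (s := {0}) fun k hk => by simp_all
  · rw [tsum_eq_single 0 fun k hk => by simp [hk]]; simp
  · rw [tsum_eq_single 0 fun k hk => by simp [hk]]; simp [sigma]

theorem eq_affine_of_sub {f g : 𝔻 → ℂ} (hf : IsAnalyticOnDisc f) (hg : IsAnalyticOnDisc g)
    (h : ∀ z : ℂ, ‖z‖ < 1 → deriv (deriv (discExt f)) z = deriv (deriv (discExt g)) z) (z : 𝔻) :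
    f z = g z + ((f 0 - g 0) + (deriv (discExt f) 0 - deriv (discExt g) 0) * z) := by
  have hd : IsAnalyticOnDisc (f - g) := by
    have h0 : discExt (f - g) = discExt f - discExt g := by
      ext z; by_cases h : ‖z‖ < 1 <;> simp [discExt, h]
    rw [IsAnalyticOnDisc, h0]
    exact DifferentiableOn.sub hf hg
  have := eq_affine_of_deriv_deriv_eq_zero hd
    (fun w hw => by rw [(deriv_discExt_sub hf hg hw).2, h w hw, sub_self]) z.norm_lt_one
  rw [discExt_coe, discExt_zero, (deriv_discExt_sub hf hg (by simp)).1] at this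
  simp only [Pi.sub_apply] at this
  rw [← this]
  ring

/-- The constant functions are atomic series. -/
theorem exists_hasAtomicBound_one : ∃ B, HasAtomicBound 1 B := by
  obtain ⟨C, hC, hatom⟩ := exists_atoms_eq
  have hm : Integrable (fun w : ℂ => conj w) areaMeasure :=
    Integrable.of_bound (C := 1) Complex.continuous_conj.aestronglyMeasurable
      (ae_area fun w hw => by rw [RCLike.norm_conj]; exact hw.le)
  -- With density `conj w`, the integral of `σ_w''` vanishes while that of `σ_w(0) = w` is `1/2`.
  -- Discretizing gives an atomic `f` with `f(0)` within `1/8` of `1/2` and `f''` so small that an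
  -- atomic `g` with `g'' = f''` has coefficient sum at most `1/8`.
  have hε : 0 < 1 / (8 * (C + 1)) := by positivity
  obtain ⟨c, a, hc, -, hca, hk⟩ := exists_atoms_near_integral hm
    (fun z hz => integrable_conj_mul_atomKernel hz) hε
  rw [integral_conj_mul_self] at hca
  have hk' : ∀ z : ℂ, ‖z‖ < 1 → ‖∑' k, c k * sigma₂ (a k) z‖ ≤ 1 / (8 * (C + 1)) := fun z hz => by
    simpa [integral_conj_mul_atomKernel hz] using hk z hz
  obtain ⟨c', a', hc', hle, heq⟩ := hatom _ (differentiableOn_tsum_sigma₂ a hc)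
    (integrable_tsum_sigma₂ a hc)
  have hle' : ∑' k, ‖c' k‖ ≤ 1 / 8 := by
    refine hle.trans ((mul_le_mul_of_nonneg_left
      (integral_norm_le_of_forall (integrable_tsum_sigma₂ a hc) hk') hC).trans ?_)
    rw [mul_one_div, div_le_iff₀ (by positivity)]
    linarith
  set f : 𝔻 → ℂ := fun z => ∑' k, c k * sigma (a k) (z : ℂ) with hf
  set g : 𝔻 → ℂ := fun z => ∑' k, c' k * sigma (a' k) (z : ℂ) with hg
  have hfB : HasAtomicBound f _ := ⟨c, a, hc, le_rfl, fun _ => rfl⟩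
  have hgB : HasAtomicBound g (1 / 8) := ⟨c', a', hc', hle', fun _ => rfl⟩
  have haff := eq_affine_of_sub (atomic_isAnalyticOnDisc hc) (atomic_isAnalyticOnDisc hc')
    (f := f) (g := g) fun z hz => by
      rw [hf, hg, atomic_deriv_deriv a hc hz, atomic_deriv_deriv a' hc' hz, heq z hz]
  set α := f 0 - g 0 with hα
  set β := deriv (discExt f) 0 - deriv (discExt g) 0
  -- `|f(0)| ≥ 3/8` while `|g(0)| ≤ 1/8`, so the affine function `f - g` has a nonzero constant
  -- term; subtracting its linear part isolates the constant.
  have hα0 : α ≠ 0 := by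
    intro h
    have h1 : f 0 = ∑' k, c k * a k := by simp [hf, sigma]
    have h2 : f 0 = g 0 := sub_eq_zero.1 h
    have h3 := hgB.norm_le 0
    rw [← h2, h1] at h3
    have h4 : (1 : ℝ) / (8 * (C + 1)) ≤ 1 / 8 := by
      rw [div_le_div_iff₀ (by positivity) (by norm_num)]; linarith
    have h5 := norm_sub_norm_le (1 / 2 : ℂ) (∑' k, c k * a k)
    have h6 : ‖(1 / 2 : ℂ)‖ = 1 / 2 := by simp
    linarith
  have hone : (1 : 𝔻 → ℂ) = α⁻¹ • (f + (-1 : ℂ) • g + (-β) • fun z : 𝔻 => (z : ℂ)) := by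
    ext z
    simp only [Pi.one_apply, Pi.smul_apply, Pi.add_apply, smul_eq_mul, haff z]
    field_simp
    ring
  rw [hone]
  exact ⟨_, ((hfB.add (hgB.smul (-1))).add (hasAtomicBound_id.smul (-β))).smul α⁻¹⟩

/-- Analytic functions with integrable second derivative are atomic series, with control of the
coefficients by the norm. -/
theorem exists_hasAtomicBound : ∃ C : ℝ, 0 ≤ C ∧ ∀ f : 𝔻 → ℂ, IsAnalyticOnDisc f →
    Integrable (deriv (deriv (discExt f))) areaMeasure → HasAtomicBound f (C * besovOneNorm f) := by
  obtain ⟨C, hC, hatom⟩ := exists_atoms_eq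
  obtain ⟨D, hD⟩ := exists_hasAtomicBound_one
  have hD0 : 0 ≤ D := (norm_nonneg _).trans (hD.norm_le 0)
  -- The three summands pay for the atoms producing `f''`, for the constant `α`, and for the linear
  -- term `β z`.
  refine ⟨C + (1 + C) * D + (1 + 2 * C), by positivity, fun f hf hi => ?_⟩
  obtain ⟨c, a, hc, hle, heq⟩ := hatom _
    ((DifferentiableOn.deriv hf isOpen_ball).deriv isOpen_ball) hi
  have hI : 0 ≤ ∫ z, ‖deriv (deriv (discExt f)) z‖ ∂areaMeasure :=
    integral_nonneg fun z => norm_nonneg _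
  have hN : besovOneNorm f = ‖f 0‖ + ‖deriv (discExt f) 0‖ +
    ∫ z, ‖deriv (deriv (discExt f)) z‖ ∂areaMeasure := rfl
  set I := ∫ z, ‖deriv (deriv (discExt f)) z‖ ∂areaMeasure
  set N := besovOneNorm f
  have hIN : C * I ≤ C * N := by
    gcongr
    linarith [norm_nonneg (f 0), norm_nonneg (deriv (discExt f) 0)]
  set g : 𝔻 → ℂ := fun z => ∑' k, c k * sigma (a k) (z : ℂ) with hg
  have hgB : HasAtomicBound g (C * N) := ⟨c, a, hc, hle.trans hIN, fun _ => rfl⟩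
  have haff := eq_affine_of_sub hf (atomic_isAnalyticOnDisc hc) (g := g) fun z hz => by
      rw [hg, atomic_deriv_deriv a hc hz, heq z hz]
  set α := f 0 - g 0 with hα
  set β := deriv (discExt f) 0 - deriv (discExt g) 0 with hβ
  have hαN : ‖α‖ ≤ (1 + C) * N := by
    have h1 := norm_sub_le (f 0) (g 0)
    have h2 := hgB.norm_le 0
    linarith [norm_nonneg (deriv (discExt f) 0)]
  have hβN : ‖β‖ ≤ (1 + 2 * C) * N := by
    have h1 := norm_sub_le (deriv (discExt f) 0) (deriv (discExt g) 0)
    have h2 := hgB.norm_deriv_zero_le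
    linarith [norm_nonneg (f 0)]
  have hfg : f = g + α • (1 : 𝔻 → ℂ) + β • fun z : 𝔻 => (z : ℂ) := by
    ext z
    simp only [Pi.one_apply, Pi.smul_apply, Pi.add_apply, smul_eq_mul]
    rw [haff z]
    ring
  have := (hgB.add (hD.smul α)).add (hasAtomicBound_id.smul β)
  rw [← hfg] at this
  obtain ⟨c, a, hc, hle, hs⟩ := this
  refine ⟨c, a, hc, hle.trans ?_, hs⟩
  have := mul_le_mul_of_nonneg_right hαN hD0
  linarith

theorem HasAtomicBound.memBesovOne {f : 𝔻 → ℂ} {B : ℝ} (hB : HasAtomicBound f B)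
    (hf : IsAnalyticOnDisc f) : MemBesovOne f := by
  obtain ⟨c, a, hc, -, hs⟩ := hB
  exact ⟨hf, c, a, hc, hs⟩

theorem memBesovOne_one : MemBesovOne 1 := by
  obtain ⟨B, hB⟩ := exists_hasAtomicBound_one
  refine hB.memBesovOne ((differentiableOn_const 1).congr fun z hz => ?_)
  rw [discExt_of_norm_lt 1 (by simpa using hz), Pi.one_apply]

/-! ### Division by `g - λ` -/

/-- The function `f / (g - r)`. -/
noncomputable def divSub (g : 𝔻 → ℂ) (r : ℂ) (f : 𝔻 → ℂ) : 𝔻 → ℂ := fun z => f z * (g z - r)⁻¹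

theorem discExt_divSub (f g : 𝔻 → ℂ) (r : ℂ) :
    EqOn (discExt (divSub g r f)) (fun z => discExt f z * (discExt g z - r)⁻¹) (ball 0 1) :=
  fun z hz => by
    have hz : ‖z‖ < 1 := by simpa using hz
    simp only [discExt_of_norm_lt _ hz, divSub]

section

variable {f g : 𝔻 → ℂ} {r : ℂ} {δ : ℝ}

theorem le_norm_discExt_sub (hδ : ∀ z, δ ≤ ‖g z - r‖) {z : ℂ} (hz : ‖z‖ < 1) :
    δ ≤ ‖discExt g z - r‖ := by
  rw [discExt_of_norm_lt _ hz]; exact hδ _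

theorem discExt_sub_ne_zero (h0 : 0 < δ) (hδ : ∀ z, δ ≤ ‖g z - r‖) {z : ℂ} (hz : ‖z‖ < 1) :
    discExt g z - r ≠ 0 :=
  norm_pos_iff.1 (h0.trans_le (le_norm_discExt_sub hδ hz))

theorem isAnalyticOnDisc_divSub (hf : IsAnalyticOnDisc f) (hg : IsAnalyticOnDisc g) (h0 : 0 < δ)
    (hδ : ∀ z, δ ≤ ‖g z - r‖) : IsAnalyticOnDisc (divSub g r f) :=
  (DifferentiableOn.mul hf ((DifferentiableOn.sub_const hg r).inv
    fun _ hz => discExt_sub_ne_zero h0 hδ (by simpa using hz))).congr (discExt_divSub f g r)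

theorem deriv_divSub (hf : IsAnalyticOnDisc f) (hg : IsAnalyticOnDisc g) (h0 : 0 < δ)
    (hδ : ∀ z, δ ≤ ‖g z - r‖) : EqOn (deriv (discExt (divSub g r f)))
      (fun z => deriv (discExt f) z * (discExt g z - r)⁻¹ -
        discExt f z * deriv (discExt g) z * ((discExt g z - r)⁻¹) ^ 2) (ball 0 1) := by
  intro z hz
  have hz' : ‖z‖ < 1 := by simpa using hz
  have hne := discExt_sub_ne_zero h0 hδ hz'
  rw [((discExt_divSub f g r).eventuallyEq_of_mem (ball_nhds hz')).deriv_eq]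
  have hF := (hf.differentiableAt (ball_nhds hz')).hasDerivAt
  have hG := ((hg.differentiableAt (ball_nhds hz')).hasDerivAt.sub_const r).fun_inv hne
  rw [(hF.fun_mul hG).deriv]
  field_simp
  ring

theorem deriv_deriv_divSub (hf : IsAnalyticOnDisc f) (hg : IsAnalyticOnDisc g) (h0 : 0 < δ)
    (hδ : ∀ z, δ ≤ ‖g z - r‖) {z : ℂ} (hz : ‖z‖ < 1) :
    deriv (deriv (discExt (divSub g r f))) z =
      deriv (deriv (discExt f)) z * (discExt g z - r)⁻¹ -
      2 * (deriv (discExt f) z * deriv (discExt g) z) * ((discExt g z - r)⁻¹) ^ 2 -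
      discExt f z * deriv (deriv (discExt g)) z * ((discExt g z - r)⁻¹) ^ 2 +
      2 * discExt f z * (deriv (discExt g) z * deriv (discExt g) z) *
        ((discExt g z - r)⁻¹) ^ 3 := by
  have hne := discExt_sub_ne_zero h0 hδ hz
  rw [((deriv_divSub hf hg h0 hδ).eventuallyEq_of_mem (ball_nhds hz)).deriv_eq]
  have hF := (hf.differentiableAt (ball_nhds hz)).hasDerivAt
  have hG := (hg.differentiableAt (ball_nhds hz)).hasDerivAt
  have hF' := ((DifferentiableOn.deriv hf isOpen_ball).differentiableAt (ball_nhds hz)).hasDerivAt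
  have hG' := ((DifferentiableOn.deriv hg isOpen_ball).differentiableAt (ball_nhds hz)).hasDerivAt
  have hH := (hG.sub_const r).fun_inv hne
  rw [((hF'.fun_mul hH).fun_sub ((hF.fun_mul hG').fun_mul (hH.fun_pow 2))).deriv]
  push_cast
  field_simp
  ring

theorem norm_deriv_deriv_divSub_le (hf : IsAnalyticOnDisc f) (hg : IsAnalyticOnDisc g)
    (h0 : 0 < δ) (hδ : ∀ z, δ ≤ ‖g z - r‖) {M : ℝ} (hM : ∀ z, ‖f z‖ ≤ M) {z : ℂ} (hz : ‖z‖ < 1) :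
    ‖deriv (deriv (discExt (divSub g r f))) z‖ ≤
      δ⁻¹ * ‖deriv (deriv (discExt f)) z‖ +
      2 * δ⁻¹ ^ 2 * ‖deriv (discExt f) z * deriv (discExt g) z‖ +
      M * δ⁻¹ ^ 2 * ‖deriv (deriv (discExt g)) z‖ +
      2 * M * δ⁻¹ ^ 3 * ‖deriv (discExt g) z * deriv (discExt g) z‖ := by
  have hK : ‖(discExt g z - r)⁻¹‖ ≤ δ⁻¹ := by
    rw [norm_inv]
    exact inv_anti₀ h0 (le_norm_discExt_sub hδ hz)
  have hFM : ‖discExt f z‖ ≤ M := by rw [discExt_of_norm_lt _ hz]; exact hM _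
  have hM0 : 0 ≤ M := (norm_nonneg _).trans hFM
  rw [deriv_deriv_divSub hf hg h0 hδ hz]
  refine (norm_add_le _ _).trans (add_le_add ((norm_sub_le _ _).trans
    (add_le_add ((norm_sub_le _ _).trans (add_le_add ?_ ?_)) ?_)) ?_)
  · rw [norm_mul, mul_comm]
    gcongr
  · rw [norm_mul, norm_mul 2, norm_pow, Complex.norm_two, mul_right_comm]
    gcongr
  · rw [norm_mul, norm_mul (discExt f z), norm_pow, mul_right_comm]
    gcongr
  · rw [norm_mul, norm_mul (2 * discExt f z), norm_mul 2 (discExt f z), norm_pow, Complex.norm_two,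
      mul_right_comm]
    gcongr

end

theorem integral_deriv_deriv_le (f : 𝔻 → ℂ) :
    ∫ z, ‖deriv (deriv (discExt f)) z‖ ∂areaMeasure ≤ besovOneNorm f := by
  rw [besovOneNorm]
  linarith [norm_nonneg (f 0), norm_nonneg (deriv (discExt f) 0)]

/-- Division by `g - r` is bounded on the space when `g` is in it and stays away from `r`. -/
theorem exists_besovOneNorm_divSub_le {g : 𝔻 → ℂ} (hg : MemBesovOne g) {r : ℂ} {δ : ℝ}
    (h0 : 0 < δ) (hδ : ∀ z, δ ≤ ‖g z - r‖) : ∃ K : ℝ, ∀ f, MemBesovOne f →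
      MemBesovOne (divSub g r f) ∧ besovOneNorm (divSub g r f) ≤ K * besovOneNorm f := by
  obtain ⟨C, hC, hatom⟩ := exists_hasAtomicBound
  have hgB := hatom g hg.1 hg.integrable
  set G := besovOneNorm g
  -- The first bracket bounds the value and derivative at the origin, the second the four terms of
  -- the second derivative.
  refine ⟨(δ⁻¹ + (δ⁻¹ + C * δ⁻¹ ^ 2 * G)) + (δ⁻¹ + 2 * δ⁻¹ ^ 2 * (2 * (C * (C * G))) +
    C * δ⁻¹ ^ 2 * G + 2 * C * δ⁻¹ ^ 3 * (2 * (C * G * (C * G)))), fun f hf => ?_⟩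
  have hfB := hatom f hf.1 hf.integrable
  have hF0 : ‖f 0‖ ≤ besovOneNorm f := by
    rw [besovOneNorm]
    linarith [norm_nonneg (deriv (discExt f) 0), integral_nonneg (μ := areaMeasure)
      (f := fun z => ‖deriv (deriv (discExt f)) z‖) fun z => norm_nonneg _]
  have hF1 : ‖deriv (discExt f) 0‖ ≤ besovOneNorm f := by
    rw [besovOneNorm]
    linarith [norm_nonneg (f 0), integral_nonneg (μ := areaMeasure)
      (f := fun z => ‖deriv (deriv (discExt f)) z‖) fun z => norm_nonneg _]
  have hG1 : ‖deriv (discExt g) 0‖ ≤ G := by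
    simp only [G, besovOneNorm]
    linarith [norm_nonneg (g 0), integral_nonneg (μ := areaMeasure)
      (f := fun z => ‖deriv (deriv (discExt g)) z‖) fun z => norm_nonneg _]
  have hF2 := integral_deriv_deriv_le f
  have hG2 : ∫ z, ‖deriv (deriv (discExt g)) z‖ ∂areaMeasure ≤ G := integral_deriv_deriv_le g
  set N := besovOneNorm f
  have hN0 : 0 ≤ N := besovOneNorm_nonneg f
  have hG0 : 0 ≤ G := besovOneNorm_nonneg g
  have han := isAnalyticOnDisc_divSub hf.1 hg.1 h0 hδ
  have hI1 := hf.integrable.norm.const_mul δ⁻¹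
  have hI2 := (integrable_deriv_mul_deriv hf hg).norm.const_mul (2 * δ⁻¹ ^ 2)
  have hI3 := hg.integrable.norm.const_mul (C * N * δ⁻¹ ^ 2)
  have hI4 := (integrable_deriv_mul_deriv hg hg).norm.const_mul (2 * (C * N) * δ⁻¹ ^ 3)
  have hbd := fun z (hz : ‖z‖ < 1) => norm_deriv_deriv_divSub_le hf.1 hg.1 h0 hδ hfB.norm_le hz
  have hint : Integrable (deriv (deriv (discExt (divSub g r f)))) areaMeasure :=
    (((hI1.add hI2).add hI3).add hI4).mono'
      ((((DifferentiableOn.deriv han isOpen_ball).deriv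
        isOpen_ball).continuousOn.aestronglyMeasurable measurableSet_ball).smul_measure _)
      (ae_area hbd)
  -- Atoms for the quotient are not built by hand: analyticity and an integrable second derivative
  -- suffice.
  refine ⟨(hatom _ han hint).memBesovOne han, ?_⟩
  have h2 : ∫ z, ‖deriv (deriv (discExt (divSub g r f))) z‖ ∂areaMeasure ≤
      δ⁻¹ * N + 2 * δ⁻¹ ^ 2 * (2 * (C * N * (C * G))) + C * N * δ⁻¹ ^ 2 * G +
        2 * (C * N) * δ⁻¹ ^ 3 * (2 * (C * G * (C * G))) := by
    refine (integral_mono_ae hint.norm (((hI1.add hI2).add hI3).add hI4) (ae_area hbd)).trans ?_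
    rw [integral_add' ((hI1.add hI2).add hI3) hI4, integral_add' (hI1.add hI2) hI3,
      integral_add' hI1 hI2, integral_const_mul, integral_const_mul, integral_const_mul,
      integral_const_mul]
    gcongr
    · exact integral_deriv_mul_deriv_le hf hg hfB hgB
    · exact integral_deriv_mul_deriv_le hg hg hgB hgB
  have hK : ∀ z, ‖(g z - r)⁻¹‖ ≤ δ⁻¹ := fun z => by
    rw [norm_inv]
    exact inv_anti₀ h0 (hδ z)
  have h3 : ‖divSub g r f 0‖ ≤ δ⁻¹ * N := by
    rw [divSub, norm_mul, mul_comm]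
    gcongr
    exact hK 0
  have h4 : ‖deriv (discExt (divSub g r f)) 0‖ ≤ δ⁻¹ * N + C * N * G * δ⁻¹ ^ 2 := by
    rw [deriv_divSub hf.1 hg.1 h0 hδ (mem_ball_self one_pos)]
    simp only [discExt_zero]
    refine (norm_sub_le _ _).trans (add_le_add ?_ ?_)
    · rw [norm_mul, mul_comm]
      gcongr
      exact hK 0
    · rw [norm_mul, norm_mul, norm_pow]
      gcongr
      · exact hfB.norm_le 0
      · exact hK 0
  rw [besovOneNorm]
  refine (add_le_add (add_le_add h3 h4) h2).trans_eq ?_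
  ring

/-! ### Point evaluations, bounded division and the spectrum -/

namespace BesovOne

theorem coe_sub (f g : BesovOne) (z : 𝔻) : (f - g) z = f z - g z := rfl

theorem coe_smul (r : ℂ) (f : BesovOne) (z : 𝔻) : (r • f) z = r * f z := rfl

theorem ext {f g : BesovOne} (h : ∀ z, f z = g z) : f = g := Subtype.ext (funext h)

/-- The constant function `1`. -/
def const : BesovOne := ⟨1, memBesovOne_one⟩

theorem const_apply (z : 𝔻) : const z = 1 := rfl

/-- A function is bounded by the coefficient sum of any atomic series for it, hence by a multiple of
its norm. -/
theorem exists_eval (z : 𝔻) : ∃ e : BesovOne →L[ℂ] ℂ, ∀ f : BesovOne, e f = f z := by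
  obtain ⟨C, hC, hatom⟩ := exists_hasAtomicBound
  let e : BesovOne →ₗ[ℂ] ℂ :=
    { toFun := fun f => f z
      map_add' := fun _ _ => rfl
      map_smul' := fun r f => coe_smul r f z }
  exact ⟨e.mkContinuous C fun f => (hatom f f.2.1 f.2.integrable).norm_le z, fun f => rfl⟩

theorem exists_divSub {g : 𝔻 → ℂ} (hg : MemBesovOne g) {r : ℂ} {δ : ℝ}
    (h0 : 0 < δ) (hδ : ∀ z, δ ≤ ‖g z - r‖) :
    ∃ S : BesovOne →L[ℂ] BesovOne, ∀ (f : BesovOne) (z : 𝔻), S f z = f z * (g z - r)⁻¹ := by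
  obtain ⟨K, hK⟩ := exists_besovOneNorm_divSub_le hg h0 hδ
  let S : BesovOne →ₗ[ℂ] BesovOne :=
    { toFun := fun f => ⟨divSub g r f, (hK f f.2).1⟩
      map_add' := fun f g => ext fun z => add_mul (f z) (g z) _
      map_smul' := fun c f => ext fun z => mul_assoc c (f z) _ }
  exact ⟨S.mkContinuous K fun f => (hK f f.2).2, fun f z => rfl⟩

end BesovOne

/-- `g = M_g 1`; this is what the membership of constants is for. -/
theorem IsMultiplicationOperator.memBesovOne {g : 𝔻 → ℂ} {T : BesovOne →L[ℂ] BesovOne}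
    (hT : IsMultiplicationOperator g T) : MemBesovOne g := by
  have h : (fun z => T BesovOne.const z) = g := funext fun z => by
    rw [hT, BesovOne.const_apply, one_mul]
  exact h ▸ (T BesovOne.const).2

theorem IsMultiplicationOperator.algebraMap_sub_apply {g : 𝔻 → ℂ} {T : BesovOne →L[ℂ] BesovOne}
    (hT : IsMultiplicationOperator g T) (r : ℂ) (f : BesovOne) (z : 𝔻) :
    (algebraMap ℂ (BesovOne →L[ℂ] BesovOne) r - T) f z = (r - g z) * f z := by
  rw [sub_apply, Algebra.algebraMap_eq_smul_one, smul_apply,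
    one_apply_eq_self, BesovOne.coe_sub, BesovOne.coe_smul, hT]
  ring

theorem IsMultiplicationOperator.isUnit_of_notMem_closure {g : 𝔻 → ℂ}
    {T : BesovOne →L[ℂ] BesovOne} (hT : IsMultiplicationOperator g T) {r : ℂ}
    (hr : r ∉ closure (range g)) : IsUnit (algebraMap ℂ (BesovOne →L[ℂ] BesovOne) r - T) := by
  rw [Metric.mem_closure_iff] at hr
  push Not at hr
  obtain ⟨δ, h0, hδ⟩ := hr
  have hδ' : ∀ z, δ ≤ ‖g z - r‖ := fun z => by
    rw [← dist_eq_norm, dist_comm]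
    exact hδ _ ⟨z, rfl⟩
  have hne : ∀ z, g z - r ≠ 0 := fun z => norm_pos_iff.1 (h0.trans_le (hδ' z))
  obtain ⟨S, hS⟩ := BesovOne.exists_divSub hT.memBesovOne h0 hδ'
  have hneg : ∀ (f : BesovOne) (z : 𝔻), (-S) f z = -(f z * (g z - r)⁻¹) := fun f z => by
    rw [← hS]; rfl
  refine ⟨⟨algebraMap ℂ (BesovOne →L[ℂ] BesovOne) r - T, -S, ?_, ?_⟩, rfl⟩
  · refine ContinuousLinearMap.ext fun f => BesovOne.ext fun z => ?_
    rw [mul_apply_eq_comp, hT.algebraMap_sub_apply, hneg, one_apply_eq_self]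
    have := hne z
    field_simp
    ring
  · refine ContinuousLinearMap.ext fun f => BesovOne.ext fun z => ?_
    rw [mul_apply_eq_comp, hneg, hT.algebraMap_sub_apply, one_apply_eq_self]
    have := hne z
    field_simp
    ring

/-- Point evaluations are eigenvectors of the adjoint of `M_g` with eigenvalues `g(z)`, so an
inverse `V` keeps `r` at distance at least `1/‖V‖` from every `g(z)`. -/
theorem IsMultiplicationOperator.not_isUnit_of_mem_closure {g : 𝔻 → ℂ}
    {T : BesovOne →L[ℂ] BesovOne} (hT : IsMultiplicationOperator g T) {r : ℂ}
    (hr : r ∈ closure (range g)) : ¬IsUnit (algebraMap ℂ (BesovOne →L[ℂ] BesovOne) r - T) := by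
  intro hu
  obtain ⟨V, hV⟩ := hu.exists_right_inv
  have key : ∀ z, 1 ≤ ‖r - g z‖ * ‖V‖ := fun z => by
    obtain ⟨e, he⟩ := BesovOne.exists_eval z
    -- Evaluation is nonzero because it takes the value `1` on the constant function; its norm can
    -- then be cancelled.
    have hpos : 0 < ‖e‖ := norm_pos_iff.2 fun h => by
      have := he BesovOne.const
      rw [h, BesovOne.const_apply] at this
      simp at this
    have h1 : ∀ f, e f = (r - g z) * e (V f) := fun f => by
      rw [he, he, ← hT.algebraMap_sub_apply, ← mul_apply_eq_comp, hV]
      rfl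
    have h2 : ‖e‖ ≤ ‖r - g z‖ * ‖V‖ * ‖e‖ := by
      refine e.opNorm_le_bound (by positivity) fun f => ?_
      rw [h1, norm_mul, mul_assoc, mul_assoc]
      gcongr
      calc ‖e (V f)‖ ≤ ‖e‖ * ‖V f‖ := e.le_opNorm _
        _ ≤ ‖e‖ * (‖V‖ * ‖f‖) := by gcongr; exact V.le_opNorm f
        _ = ‖V‖ * (‖e‖ * ‖f‖) := by ring
    exact le_of_mul_le_mul_right (by rwa [one_mul]) hpos
  obtain ⟨-, ⟨z, rfl⟩, hz⟩ := Metric.mem_closure_iff.1 hr (1 / (‖V‖ + 1)) (by positivity)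
  rw [dist_eq_norm, lt_div_iff₀ (by positivity)] at hz
  have := key z
  nlinarith [norm_nonneg (r - g z)]

end MinimalMobius

theorem theorem12 (g : 𝔻 → ℂ) (hg : MinimalMobius.IsAnalyticOnDisc g)
    (T : MinimalMobius.BesovOne →L[ℂ] MinimalMobius.BesovOne)
    (hT : MinimalMobius.IsMultiplicationOperator g T) :
    spectrum ℂ T = closure (Set.range g) := by
  ext r
  rw [spectrum.mem_iff]
  exact ⟨fun h => by_contra fun hr => h (hT.isUnit_of_notMem_closure hr),
    hT.not_isUnit_of_mem_closure⟩
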